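/- Let $\mathsf{HA}$ be intuitionistic first-order arithmetic (logical constants $\forall,\exists,\to,\land,\lor,\perp$; $\neg\varphi$ is $\varphi\to\perp$; function symbols for all primitive recursive functions). $\mathrm{FV}(\varphi)$ is the set of free variables of $\varphi$. $\Sigma_0=\Pi_0$ is the class of quantifier-free formulas; $\Sigma_{k+1}$ is the class of formulas $\exists\overline{x}\,\psi$ with $\overline{x}$ a non-empty list of variables and $\psi\in\Pi_k$, and $\Pi_{k+1}$ the class of formulas $\forall\overline{x}\,\psi$ with $\overline{x}$ non-empty and $\psi\in\Sigma_k$. To a formula $\varphi$ one assigns a finite set $\mathrm{Alt}(\varphi)$ of alternating sequences of signs $+,-$. If $\varphi$ is quantifier-free, $\mathrm{Alt}(\varphi)=\{\langle\,\rangle\}$. Otherwise, with $s^{\perp}$ denoting $s$ with all signs switched: $\mathrm{Alt}(\neg\varphi_1)=\{s^\perp \mid s\in\mathrm{Alt}(\varphi_1)\}$; $\mathrm{Alt}(\varphi_1\land\varphi_2)=\mathrm{Alt}(\varphi_1\lor\varphi_2)=\mathrm{Alt}(\varphi_1)\cup\mathrm{Alt}(\varphi_2)$; $\mathrm{Alt}(\varphi_1\to\varphi_2)=\{s^\perp\mid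 s\in\mathrm{Alt}(\varphi_1)\}\cup\mathrm{Alt}(\varphi_2)$ for $\varphi_2\not\equiv\perp$; $\mathrm{Alt}(\forall x\,\varphi_1)$ (resp. $\mathrm{Alt}(\exists x\,\varphi_1)$) is obtained from $\mathrm{Alt}(\varphi_1)$ by putting $-$ (resp. $+$) in front of every $s$ that does not already begin with that sign. Let $\mathrm{F}_k$ be the class of formulas for which the greatest length of a sequence in $\mathrm{Alt}(\varphi)$ is $k$. Let $\mathrm{U}_0=\mathrm{E}_0=\mathrm{F}_0$; for $k>0$ let $\mathrm{U}_k$ (resp. $\mathrm{E}_k$) be the class of those $\varphi\in\mathrm{F}_k$ for which every $s\in\mathrm{Alt}(\varphi)$ of length $k$ begins with $-$ (resp. $+$). Put $\mathrm{U}_k^+=\mathrm{U}_k\cup\bigcup_{i<k}\mathrm{F}_i$ and $\mathrm{E}_k^+=\mathrm{E}_k\cup\bigcup_{i<k}\mathrm{F}_i$. For a class $\Gamma$ of formulas consider the following schemata of sentences: - $\Gamma\text{-}\mathrm{DNE}$: $\forall x(\neg\neg\varphi(x)\to\varphi(x))$ for $\varphi\in\Gamma$ with $\mathrm{FV}(\varphi)\subseteq\{x\}$;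 - $(\Gamma\lor\Gamma)\text{-}\mathrm{DNE}$: $\forall x(\neg\neg(\varphi(x)\lor\psi(x))\to\varphi(x)\lor\psi(x))$ for $\varphi,\psi\in\Gamma$ with $\mathrm{FV}(\varphi),\mathrm{FV}(\psi)\subseteq\{x\}$; - $\Gamma\text{-}\mathrm{DNS}$: $\forall x(\forall y\,\neg\neg\varphi(x,y)\to\neg\neg\forall y\,\varphi(x,y))$ for $\varphi\in\Gamma$ with $\mathrm{FV}(\varphi)\subseteq\{x,y\}$. **Theorem.** For each natural number $k$ and each formula $\varphi$ (possibly containing free variables), the following hold. 1. If $\varphi\in\mathrm{E}_k^+$, then there exists $\varphi'\in\Sigma_k$ such that $\mathrm{FV}(\varphi)=\mathrm{FV}(\varphi')$ and $$\mathsf{HA}+\Sigma_k\text{-}\mathrm{DNE}+\mathrm{U}_k^+\text{-}\mathrm{DNS}\vdash\varphi\leftrightarrow\varphi'.$$ 2. If $\varphi\in\mathrm{U}_k^+$, then there exists $\varphi'\in\Pi_k$ such that $\mathrm{FV}(\varphi)=\mathrm{FV}(\varphi')$ and $$\mathsf{HA}+(\Pi_k\lor\Pi_k)\text{-}\mathrm{DNE}\vdash\varphi\leftrightarrow\varphi'.$$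 -/

import Mathlib

namespace HeytingArith

open FirstOrder

/-! ## The language of arithmetic -/

/-- Function symbols, one for each primitive recursive definition; the index is the arity. -/
inductive PRSymb : ℕ → Type
  /-- The constant `0`. -/
  | zero : PRSymb 0
  /-- The successor symbol `S`. -/
  | succ : PRSymb 1
  /-- The `i`-th `n`-ary projection. -/
  | proj {n : ℕ} (i : Fin n) : PRSymb n
  /-- Composition: the function `f (g₀ x) … (gₘ₋₁ x)` of the tuple `x`. -/
  | comp {m n : ℕ} (f : PRSymb m) (g : Fin m → PRSymb n) : PRSymb n
  /-- Primitive recursion in the first argument: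
  `h (0, x) = f x` and `h (S y, x) = g (y, h (y, x), x)`. -/
  | prec {n : ℕ} (f : PRSymb n) (g : PRSymb (n + 2)) : PRSymb (n + 1)

/-- The language of arithmetic: a function symbol for every primitive recursive definition and no
predicate symbol besides equality. -/
abbrev lang : Language := ⟨PRSymb, fun _ => Empty⟩

/-- Terms of arithmetic; the variables are the natural numbers. -/
abbrev Tm : Type := lang.Term ℕ

/-- The variable with number `i`. -/
abbrev Tm.v (i : ℕ) : Tm := Language.Term.var i

/-- The application of a function symbol to arguments. -/
abbrev Tm.app {n : ℕ} (f : PRSymb n) (ts : Fin n → Tm) : Tm :=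
  Language.Term.func (L := lang) f ts

/-- The term `0`. -/
def Tm.zero : Tm := Tm.app PRSymb.zero Fin.elim0

/-- The term `S t`. -/
def Tm.succ (t : Tm) : Tm := Tm.app PRSymb.succ (fun _ => t)

/-- First-order formulas, up to renaming of bound variables: in `all φ` and `ex φ` the variable `0`
of `φ` is bound by the quantifier, and the variable `n + 1` of `φ` is the variable `n` outside. -/
inductive Fml : Type
  | bot : Fml
  | eq (s t : Tm) : Fml
  | and (φ ψ : Fml) : Fml
  | or (φ ψ : Fml) : Fml
  | imp (φ ψ : Fml) : Fml
  | all (φ : Fml) : Fml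
  | ex (φ : Fml) : Fml

namespace Fml

/-- Negation `¬ φ`, which abbreviates `φ → ⊥`. -/
def neg (φ : Fml) : Fml := imp φ bot

/-- Double negation. -/
def nn (φ : Fml) : Fml := neg (neg φ)

/-- The biconditional. -/
def iff (φ ψ : Fml) : Fml := and (imp φ ψ) (imp ψ φ)

/-- The set of free variables. -/
def FV : Fml → Set ℕ
  | bot => ∅
  | eq s t => (s.varFinset : Set ℕ) ∪ (t.varFinset : Set ℕ)
  | and φ ψ => φ.FV ∪ ψ.FV
  | or φ ψ => φ.FV ∪ ψ.FV
  | imp φ ψ => φ.FV ∪ ψ.FV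
  | all φ => {n | n + 1 ∈ φ.FV}
  | ex φ => {n | n + 1 ∈ φ.FV}

/-- Quantifier-free formulas. -/
def QF : Fml → Prop
  | bot => True
  | eq _ _ => True
  | and φ ψ => φ.QF ∧ ψ.QF
  | or φ ψ => φ.QF ∧ ψ.QF
  | imp φ ψ => φ.QF ∧ ψ.QF
  | all _ => False
  | ex _ => False

end Fml

/-- The substitution with `0 ↦ t` and `n + 1 ↦ σ n`. -/
def scons (t : Tm) (σ : ℕ → Tm) : ℕ → Tm
  | 0 => t
  | n + 1 => σ n

/-- A substitution carried under one quantifier. -/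
def lift (σ : ℕ → Tm) : ℕ → Tm :=
  scons (Tm.v 0) (fun n => (σ n).relabel Nat.succ)

namespace Fml

/-- Simultaneous capture-avoiding substitution of terms for the free variables. -/
def subst : Fml → (ℕ → Tm) → Fml
  | bot, _ => bot
  | eq s t, σ => eq (s.subst σ) (t.subst σ)
  | and φ ψ, σ => and (φ.subst σ) (ψ.subst σ)
  | or φ ψ, σ => or (φ.subst σ) (ψ.subst σ)
  | imp φ ψ, σ => imp (φ.subst σ) (ψ.subst σ)
  | all φ, σ => all (φ.subst (lift σ))
  | ex φ, σ => ex (φ.subst (lift σ))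

/-- `φ`, seen under one more quantifier that does not bind any variable of it. -/
def shift (φ : Fml) : Fml := φ.subst (fun n => Tm.v (n + 1))

/-- The instance `φ(t)` of the body `φ` of a quantified formula. -/
def inst (φ : Fml) (t : Tm) : Fml := φ.subst (scons t Tm.v)

/-- `φ(S x)`, where `x` is the variable `0` of `φ`. -/
def instSucc (φ : Fml) : Fml :=
  φ.subst (scons (Tm.succ (Tm.v 0)) (fun n => Tm.v (n + 1)))

end Fml

/-! ## Intuitionistic provability and Heyting arithmetic -/

/-- Natural deduction for intuitionistic first-order logic with equality: `Derives T Γ φ` says that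
`φ` has a derivation from the axioms `T` and the open assumptions `Γ`. A free variable of an axiom
is read as universally quantified, that of an assumption is a parameter. -/
inductive Derives (T : Set Fml) : List Fml → Fml → Prop
  | ax {Γ : List Fml} {φ : Fml} : φ ∈ T → Derives T Γ φ
  | hyp {Γ : List Fml} {φ : Fml} : φ ∈ Γ → Derives T Γ φ
  | botE {Γ : List Fml} {φ : Fml} : Derives T Γ Fml.bot → Derives T Γ φ
  | andI {Γ : List Fml} {φ ψ : Fml} :
      Derives T Γ φ → Derives T Γ ψ → Derives T Γ (Fml.and φ ψ)
  | andE₁ {Γ : List Fml} {φ ψ : Fml} : Derives T Γ (Fml.and φ ψ) → Derives T Γ φ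
  | andE₂ {Γ : List Fml} {φ ψ : Fml} : Derives T Γ (Fml.and φ ψ) → Derives T Γ ψ
  | orI₁ {Γ : List Fml} {φ ψ : Fml} : Derives T Γ φ → Derives T Γ (Fml.or φ ψ)
  | orI₂ {Γ : List Fml} {φ ψ : Fml} : Derives T Γ ψ → Derives T Γ (Fml.or φ ψ)
  | orE {Γ : List Fml} {φ ψ χ : Fml} : Derives T Γ (Fml.or φ ψ) →
      Derives T (φ :: Γ) χ → Derives T (ψ :: Γ) χ → Derives T Γ χ
  | impI {Γ : List Fml} {φ ψ : Fml} : Derives T (φ :: Γ) ψ → Derives T Γ (Fml.imp φ ψ)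
  | impE {Γ : List Fml} {φ ψ : Fml} :
      Derives T Γ (Fml.imp φ ψ) → Derives T Γ φ → Derives T Γ ψ
  | allI {Γ : List Fml} {φ : Fml} :
      Derives T (Γ.map Fml.shift) φ → Derives T Γ (Fml.all φ)
  | allE {Γ : List Fml} {φ : Fml} (t : Tm) :
      Derives T Γ (Fml.all φ) → Derives T Γ (φ.inst t)
  | exI {Γ : List Fml} {φ : Fml} (t : Tm) :
      Derives T Γ (φ.inst t) → Derives T Γ (Fml.ex φ)
  | exE {Γ : List Fml} {φ ψ : Fml} : Derives T Γ (Fml.ex φ) →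
      Derives T (φ :: Γ.map Fml.shift) ψ.shift → Derives T Γ ψ
  | eqRefl {Γ : List Fml} (t : Tm) : Derives T Γ (Fml.eq t t)
  | eqSubst {Γ : List Fml} {φ : Fml} {s t : Tm} :
      Derives T Γ (Fml.eq s t) → Derives T Γ (φ.inst s) → Derives T Γ (φ.inst t)

/-- `T ⊢ φ` in intuitionistic first-order logic with equality. -/
def Provable (T : Set Fml) (φ : Fml) : Prop := Derives T [] φ

/-- The non-logical axioms of Heyting arithmetic. -/
inductive HAAxiom : Fml → Prop
  | succ_ne_zero (t : Tm) : HAAxiom (Fml.neg (Fml.eq (Tm.succ t) Tm.zero))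
  | succ_inj (s t : Tm) :
      HAAxiom (Fml.imp (Fml.eq (Tm.succ s) (Tm.succ t)) (Fml.eq s t))
  | proj {n : ℕ} (i : Fin n) (ts : Fin n → Tm) :
      HAAxiom (Fml.eq (Tm.app (PRSymb.proj i) ts) (ts i))
  | comp {m n : ℕ} (f : PRSymb m) (g : Fin m → PRSymb n) (ts : Fin n → Tm) :
      HAAxiom (Fml.eq (Tm.app (PRSymb.comp f g) ts)
        (Tm.app f (fun i => Tm.app (g i) ts)))
  | prec_zero {n : ℕ} (f : PRSymb n) (g : PRSymb (n + 2)) (ts : Fin n → Tm) :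
      HAAxiom (Fml.eq (Tm.app (PRSymb.prec f g) (Fin.cons Tm.zero ts)) (Tm.app f ts))
  | prec_succ {n : ℕ} (f : PRSymb n) (g : PRSymb (n + 2)) (t : Tm) (ts : Fin n → Tm) :
      HAAxiom (Fml.eq (Tm.app (PRSymb.prec f g) (Fin.cons (Tm.succ t) ts))
        (Tm.app g (Fin.cons t
          (Fin.cons (Tm.app (PRSymb.prec f g) (Fin.cons t ts)) ts))))
  | induction (φ : Fml) :
      HAAxiom (Fml.imp
        (Fml.and (φ.inst Tm.zero) (Fml.all (Fml.imp φ φ.instSucc))) (Fml.all φ))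

/-- Heyting arithmetic. -/
def HA : Set Fml := {φ | HAAxiom φ}

/-! ## Classes of formulas -/

mutual

/-- `Σ_k`: formulas with `k` alternating non-empty blocks of quantifiers, the first existential, in
front of a quantifier-free formula. -/
def SigmaClass : ℕ → Set Fml
  | 0 => {φ | φ.QF}
  | k + 1 => {φ | ∃ n : ℕ, ∃ ψ ∈ PiClass k, φ = Fml.ex^[n + 1] ψ}

/-- `Π_k`: formulas with `k` alternating non-empty blocks of quantifiers, the first universal, in
front of a quantifier-free formula. -/
def PiClass : ℕ → Set Fml
  | 0 => {φ | φ.QF}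
  | k + 1 => {φ | ∃ n : ℕ, ∃ ψ ∈ SigmaClass k, φ = Fml.all^[n + 1] ψ}

end

/-- Alternation paths as lists of signs: `true` is `+` and `false` is `-`. This is the path `s`
itself if it begins with the sign `b`, and the path `b s` otherwise. -/
def prependSign (b : Bool) (s : List Bool) : List Bool :=
  if s.head? = some b then s else b :: s

/-- The path `s^⊥`: all signs are switched. -/
def switchSigns (s : List Bool) : List Bool := s.map Bool.not

/-- The finite set of alternation paths of a formula. -/
def alt : Fml → Finset (List Bool)
  | Fml.bot => {[]}
  | Fml.eq _ _ => {[]}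
  | Fml.and φ ψ => alt φ ∪ alt ψ
  | Fml.or φ ψ => alt φ ∪ alt ψ
  | Fml.imp φ Fml.bot => (alt φ).image switchSigns
  | Fml.imp φ ψ => (alt φ).image switchSigns ∪ alt ψ
  | Fml.all φ => (alt φ).image (prependSign false)
  | Fml.ex φ => (alt φ).image (prependSign true)

/-- The degree of a formula: the greatest length of one of its alternation paths. -/
def degree (φ : Fml) : ℕ := (alt φ).sup List.length

/-- `F_k`. -/
def FClass (k : ℕ) : Set Fml := {φ | degree φ = k}

/-- `U_k`. -/
def UClass : ℕ → Set Fml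
  | 0 => FClass 0
  | k + 1 => {φ ∈ FClass (k + 1) |
      ∀ s ∈ alt φ, s.length = k + 1 → s.head? = some false}

/-- `E_k`. -/
def EClass : ℕ → Set Fml
  | 0 => FClass 0
  | k + 1 => {φ ∈ FClass (k + 1) |
      ∀ s ∈ alt φ, s.length = k + 1 → s.head? = some true}

/-- `U_k^+`. -/
def UPlus (k : ℕ) : Set Fml := UClass k ∪ ⋃ i < k, FClass i

/-- `E_k^+`. -/
def EPlus (k : ℕ) : Set Fml := EClass k ∪ ⋃ i < k, FClass i

/-! ## Logical principles -/

/-- `Γ`-DNE: the sentences `∀ x (¬¬ φ(x) → φ(x))` with `φ` in `Γ` and no free variable but `x`. -/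
def DNE (Γ : Set Fml) : Set Fml :=
  {χ | ∃ φ ∈ Γ, φ.FV ⊆ {0} ∧ χ = Fml.all (Fml.imp φ.nn φ)}

/-- `(Γ ∨ Γ')`-DNE: the sentences `∀ x (¬¬ (φ(x) ∨ ψ(x)) → φ(x) ∨ ψ(x))` with `φ` in `Γ` and `ψ` in
`Γ'`, neither with a free variable other than `x`. -/
def DNEOr (Γ Γ' : Set Fml) : Set Fml :=
  {χ | ∃ φ ∈ Γ, ∃ ψ ∈ Γ', φ.FV ⊆ {0} ∧ ψ.FV ⊆ {0} ∧
    χ = Fml.all (Fml.imp (Fml.or φ ψ).nn (Fml.or φ ψ))}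

/-- `Γ`-DNS: the sentences `∀ x (∀ y ¬¬ φ(x, y) → ¬¬ ∀ y φ(x, y))` with `φ` in `Γ` and no free
variables but `x` and `y`; in `φ` the variable `0` is `y` and the variable `1` is `x`. -/
def DNS (Γ : Set Fml) : Set Fml :=
  {χ | ∃ φ ∈ Γ, φ.FV ⊆ {0, 1} ∧
    χ = Fml.all (Fml.imp (Fml.all φ.nn) (Fml.all φ).nn)}

end HeytingArith

open HeytingArith

/-!
Write `Σ` and `Π` for the prenex classes. Everything is proved for an arbitrary set of axioms `T`
containing `HA`, under one of two assumptions in which parameters are unrestricted: `T` proves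
`Σ_k`-DNE and `U_k^+`-DNS (`ProvesDNEAndDNS`), or `T` proves `(Π_k ∨ Π_k)`-DNE (`ProvesDNEOr`).

The theorem is proved by induction on `k` and, inside, on the formula, in a form that also treats
negations (`PrenexAt`): under the first assumption `φ` is equivalent to a `Σ_k` formula if `φ` is in
`E_k^+`, and `¬ φ` is so if `φ` is in `U_k^+`; under the second assumption `φ` is equivalent to a
`Π_k` formula if `φ` is in `U_k^+`, and `¬ φ` is so if `φ` is in `E_k^+`. The negations are needed
because the premise of an implication lies in the opposite class. In both cases the formulas with a
prenex form are stable and closed under `∧` and `∨`, so the connectives reduce to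
`φ → ψ ↔ ¬ φ ∨ ψ`, `¬ (φ ∧ ψ) ↔ ¬ φ ∨ ¬ ψ` and `¬ (φ → ψ) ↔ φ ∧ ¬ ψ`, whose right-hand sides are
stable or have stable components (`connective_steps`). For the quantifiers there are two
possibilities. A quantifier of the sign of the class is kept, and double negation shift gives
`¬ ∀ x φ ↔ ∃ x ¬ φ`. A formula beginning with a quantifier of the wrong sign lies one level lower
(`SignBounded.quant_not`), and then the induction hypothesis on `k` applies, because each assumption
at level `k + 1` implies the other one at level `k`.

Closure under disjunction has two different reasons. A disjunction of `Π_k` formulas is `Σ_{k+1}` in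
`HA` alone, since `φ ∨ ψ` is equivalent to `∃ z ((z = 0 → φ) ∧ (z ≠ 0 → ψ))` and `z = 0` is
decidable. For the class `Π_{k+1}` it is `(Π ∨ Π)`-DNE that moves universal quantifiers across a
disjunction.

The axiom schemata have only one parameter. That this is no restriction follows from a primitive
recursive enumeration of all pairs of numbers (`provable_of_one_parameter`). It is obtained from a
countdown function `down` that begins again at larger and larger values, and from the number `block`
of the times that it has begun again: both are defined by a plain primitive recursion, and their
properties need no arithmetic beyond a few inductions on addition.
-/

namespace HeytingArith

open FirstOrder

/-! ### Substitution -/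

@[simp] theorem scons_zero (t : Tm) (σ : ℕ → Tm) : scons t σ 0 = t := rfl

@[simp] theorem scons_succ (t : Tm) (σ : ℕ → Tm) (n : ℕ) : scons t σ (n + 1) = σ n := rfl

@[simp] theorem lift_zero (σ : ℕ → Tm) : lift σ 0 = Tm.v 0 := rfl

@[simp] theorem lift_succ (σ : ℕ → Tm) (n : ℕ) :
    lift σ (n + 1) = (σ n).relabel Nat.succ := rfl

namespace Tm

theorem subst_var (t : Tm) : t.subst Tm.v = t := by
  induction t with
  | var => rfl
  | func f ts ih => simp [ih]

theorem relabel_eq_subst (f : ℕ → ℕ) (t : Tm) : t.relabel f = t.subst (fun n => Tm.v (f n)) := by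
  induction t with
  | var => rfl
  | func g ts ih => simp [ih]

theorem subst_subst (t : Tm) (σ τ : ℕ → Tm) :
    (t.subst σ).subst τ = t.subst (fun n => (σ n).subst τ) := by
  induction t with
  | var => rfl
  | func f ts ih => simp [ih]

theorem subst_congr {t : Tm} {σ τ : ℕ → Tm} (h : ∀ n ∈ t.varFinset, σ n = τ n) :
    t.subst σ = t.subst τ := by
  induction t with
  | var n => exact h n (by simp)
  | func f ts ih =>
    simp only [Language.Term.subst]
    congr 1
    funext i
    exact ih i fun n hn => h n (by simpa using ⟨i, hn⟩)

theorem mem_varFinset_subst {t : Tm} {σ : ℕ → Tm} {m : ℕ} :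
    m ∈ (t.subst σ).varFinset ↔ ∃ n ∈ t.varFinset, m ∈ (σ n).varFinset := by
  induction t with
  | var n => simp
  | func f ts ih =>
    simp only [Language.Term.subst, Language.Term.varFinset, Finset.mem_biUnion,
      Finset.mem_univ, true_and, ih]
    exact ⟨fun ⟨i, n, h, h'⟩ => ⟨n, ⟨i, h⟩, h'⟩, fun ⟨n, ⟨i, h⟩, h'⟩ => ⟨i, n, h, h'⟩⟩

theorem mem_varFinset_relabel_succ {t : Tm} {m : ℕ} :
    m ∈ (t.relabel Nat.succ).varFinset ↔ ∃ n ∈ t.varFinset, m = n + 1 := by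
  rw [relabel_eq_subst, mem_varFinset_subst]
  simp

@[simp] theorem relabel_succ_subst_scons (t s : Tm) (σ : ℕ → Tm) :
    (t.relabel Nat.succ).subst (scons s σ) = t.subst σ := by
  rw [relabel_eq_subst, subst_subst]
  rfl

@[simp] theorem relabel_succ_subst_lift (t : Tm) (σ : ℕ → Tm) :
    (t.relabel Nat.succ).subst (lift σ) = (t.subst σ).relabel Nat.succ := by
  rw [relabel_eq_subst, relabel_eq_subst, subst_subst, subst_subst]
  congr 1
  funext n
  exact relabel_eq_subst _ _

end Tm

theorem lift_v : lift Tm.v = Tm.v := by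
  funext n
  cases n <;> rfl

theorem lift_comp (σ τ : ℕ → Tm) :
    (fun n => (lift σ n).subst (lift τ)) = lift (fun n => (σ n).subst τ) := by
  funext n
  cases n with
  | zero => rfl
  | succ n => simp

namespace Fml

theorem subst_v (φ : Fml) : φ.subst Tm.v = φ := by
  induction φ with
  | bot => rfl
  | eq s t => simp [subst, Tm.subst_var]
  | and φ ψ h h' => simp [subst, h, h']
  | or φ ψ h h' => simp [subst, h, h']
  | imp φ ψ h h' => simp [subst, h, h']
  | all φ h => simp [subst, lift_v, h]
  | ex φ h => simp [subst, lift_v, h]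

theorem subst_subst (φ : Fml) (σ τ : ℕ → Tm) :
    (φ.subst σ).subst τ = φ.subst (fun n => (σ n).subst τ) := by
  induction φ generalizing σ τ with
  | bot => rfl
  | eq s t => simp [subst, Tm.subst_subst]
  | and φ ψ h h' => simp [subst, h, h']
  | or φ ψ h h' => simp [subst, h, h']
  | imp φ ψ h h' => simp [subst, h, h']
  | all φ h => simp [subst, lift_comp, h]
  | ex φ h => simp [subst, lift_comp, h]

theorem subst_congr {φ : Fml} {σ τ : ℕ → Tm} (h : ∀ n ∈ φ.FV, σ n = τ n) :
    φ.subst σ = φ.subst τ := by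
  induction φ generalizing σ τ with
  | bot => rfl
  | eq s t =>
    simp only [subst]
    rw [Tm.subst_congr fun n hn => h n (Or.inl hn), Tm.subst_congr fun n hn => h n (Or.inr hn)]
  | and φ ψ h₁ h₂ | or φ ψ h₁ h₂ | imp φ ψ h₁ h₂ =>
    simp only [subst]
    rw [h₁ fun n hn => h n (Or.inl hn), h₂ fun n hn => h n (Or.inr hn)]
  | all φ ih | ex φ ih =>
    simp only [subst]
    rw [ih]
    rintro (_ | n) hn
    · rfl
    · simp [h n hn]

theorem mem_FV_subst {φ : Fml} {σ : ℕ → Tm} {m : ℕ} :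
    m ∈ (φ.subst σ).FV ↔ ∃ n ∈ φ.FV, m ∈ (σ n).varFinset := by
  have quant (A : Set ℕ) (σ : ℕ → Tm) (m : ℕ) :
      (∃ n ∈ A, m + 1 ∈ (lift σ n).varFinset) ↔
        ∃ n ∈ {n | n + 1 ∈ A}, m ∈ (σ n).varFinset := by
    constructor
    · rintro ⟨_ | n, hn, hm⟩
      · simp at hm
      · rw [lift_succ, Tm.mem_varFinset_relabel_succ] at hm
        obtain ⟨j, hj, e⟩ := hm
        exact ⟨n, hn, by rwa [Nat.succ_injective e]⟩
    · rintro ⟨n, hn, hm⟩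
      exact ⟨n + 1, hn, by rw [lift_succ, Tm.mem_varFinset_relabel_succ]; exact ⟨m, hm, rfl⟩⟩
  induction φ generalizing σ m with
  | bot => simp [subst, FV]
  | eq s t =>
    simp only [subst, FV, Set.mem_union, Finset.mem_coe, Tm.mem_varFinset_subst, or_and_right,
      exists_or]
  | and φ ψ h h' | or φ ψ h h' | imp φ ψ h h' =>
    simp only [subst, FV, Set.mem_union, h, h', or_and_right, exists_or]
  | all φ h | ex φ h =>
    simp only [subst, FV, Set.mem_ofPred_eq, h]
    exact quant _ _ _

theorem mem_FV_shift {φ : Fml} {m : ℕ} : m ∈ φ.shift.FV ↔ ∃ n ∈ φ.FV, m = n + 1 := by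
  simp [shift, mem_FV_subst]

@[simp] theorem succ_mem_FV_shift {φ : Fml} {m : ℕ} : m + 1 ∈ φ.shift.FV ↔ m ∈ φ.FV := by
  simp [mem_FV_shift]

@[simp] theorem shift_inst (φ : Fml) (t : Tm) : φ.shift.inst t = φ := by
  rw [shift, inst, subst_subst]
  exact subst_v φ

theorem subst_lift_inst (φ : Fml) (σ : ℕ → Tm) (t : Tm) :
    (φ.subst (lift σ)).inst t = φ.subst (scons t σ) := by
  rw [inst, subst_subst]
  congr 1
  funext n
  cases n with
  | zero => rfl
  | succ n => simp [Tm.subst_var]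

/-- The body of a shifted quantified formula, instantiated at the new variable, is the body. -/
@[simp] theorem subst_lift_inst_v (φ : Fml) :
    (φ.subst (lift (fun n => Tm.v (n + 1)))).inst (Tm.v 0) = φ := by
  rw [subst_lift_inst]
  conv_rhs => rw [← subst_v φ]
  congr 1
  funext n
  cases n <;> rfl

end Fml

/-! ### Natural deduction -/

namespace Derives

variable {T : Set Fml} {Γ Δ : List Fml} {φ ψ χ θ : Fml}

theorem weaken (h : Derives T Γ φ) (hs : Γ ⊆ Δ) : Derives T Δ φ := by
  induction h generalizing Δ with
  | ax h => exact ax h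
  | hyp h => exact hyp (hs h)
  | botE _ ih => exact botE (ih hs)
  | andI _ _ ih ih' => exact andI (ih hs) (ih' hs)
  | andE₁ _ ih => exact andE₁ (ih hs)
  | andE₂ _ ih => exact andE₂ (ih hs)
  | orI₁ _ ih => exact orI₁ (ih hs)
  | orI₂ _ ih => exact orI₂ (ih hs)
  | orE _ _ _ ih ih₁ ih₂ =>
    exact orE (ih hs) (ih₁ (List.cons_subset_cons _ hs)) (ih₂ (List.cons_subset_cons _ hs))
  | impI _ ih => exact impI (ih (List.cons_subset_cons _ hs))
  | impE _ _ ih ih' => exact impE (ih hs) (ih' hs)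
  | allI _ ih => exact allI (ih (List.map_subset _ hs))
  | allE t _ ih => exact allE t (ih hs)
  | exI t _ ih => exact exI t (ih hs)
  | exE _ _ ih ih' =>
    exact exE (ih hs) (ih' (List.cons_subset_cons _ (List.map_subset _ hs)))
  | eqRefl t => exact eqRefl t
  | eqSubst _ _ ih ih' => exact eqSubst (ih hs) (ih' hs)

theorem of_provable (h : Provable T φ) : Derives T Γ φ := h.weaken (List.nil_subset _)

/-! The assumptions `h0`, `h1`, `h2`, `h3` are those at the front of the context, in order. -/

theorem h0 : Derives T (φ :: Γ) φ := hyp (by simp)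

theorem h1 : Derives T (ψ :: φ :: Γ) φ := hyp (by simp)

theorem h2 : Derives T (χ :: ψ :: φ :: Γ) φ := hyp (by simp)

theorem h3 : Derives T (θ :: χ :: ψ :: φ :: Γ) φ := hyp (by simp)

theorem cut (h : Derives T Γ φ) (h' : Derives T (φ :: Γ) ψ) : Derives T Γ ψ := impE (impI h') h

/-- Elimination of a shifted universal quantifier in favour of the new variable. -/
theorem allE_shift (h : Derives T Γ (Fml.all φ).shift) : Derives T Γ φ := by
  have := allE (Tm.v 0) h
  rwa [Fml.subst_lift_inst_v] at this

/-- Introduction of a shifted existential quantifier with the new variable as a witness. -/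
theorem exI_shift (h : Derives T Γ φ) : Derives T Γ (Fml.ex φ).shift := by
  refine exI (Tm.v 0) ?_
  rwa [Fml.subst_lift_inst_v]

end Derives

/-! ### Prenex classes -/

/-- The quantifier of sign `b`: existential for `true`, universal for `false`. -/
def Fml.quant : Bool → Fml → Fml
  | true => Fml.ex
  | false => Fml.all

/-- The prenex class of level `k` beginning with the quantifier of sign `b`: this is `Σ_k` for
`true` and `Π_k` for `false`. -/
def prenex : Bool → ℕ → Set Fml
  | true => SigmaClass
  | false => PiClass

theorem mem_prenex_zero {b : Bool} {φ : Fml} : φ ∈ prenex b 0 ↔ φ.QF := by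
  cases b
  · simp [prenex, PiClass]
  · simp [prenex, SigmaClass]

theorem mem_prenex_succ {b : Bool} {k : ℕ} {φ : Fml} :
    φ ∈ prenex b (k + 1) ↔ ∃ n : ℕ, ∃ ψ ∈ prenex (!b) k, φ = (Fml.quant b)^[n + 1] ψ := by
  cases b
  · simp only [prenex, PiClass]
    rfl
  · simp only [prenex, SigmaClass]
    rfl

theorem quant_mem_prenex_of_other {b : Bool} {k : ℕ} {φ : Fml} (h : φ ∈ prenex (!b) k) :
    φ.quant b ∈ prenex b (k + 1) :=
  mem_prenex_succ.2 ⟨0, φ, h, rfl⟩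

theorem quant_mem_prenex {b : Bool} {k : ℕ} {φ : Fml} (h : φ ∈ prenex b (k + 1)) :
    φ.quant b ∈ prenex b (k + 1) := by
  obtain ⟨n, ψ, hψ, rfl⟩ := mem_prenex_succ.1 h
  exact mem_prenex_succ.2 ⟨n + 1, ψ, hψ, (Function.iterate_succ_apply' _ _ _).symm⟩

/-- Induction on the length of the first block of quantifiers of a prenex formula. -/
theorem prenex_succ_induction {b : Bool} {k : ℕ} {P : Fml → Prop}
    (other : ∀ φ ∈ prenex (!b) k, P (φ.quant b))
    (same : ∀ φ ∈ prenex b (k + 1), P φ → P (φ.quant b)) :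
    ∀ φ ∈ prenex b (k + 1), P φ := by
  intro φ hφ
  obtain ⟨n, ψ, hψ, rfl⟩ := mem_prenex_succ.1 hφ
  clear hφ
  induction n with
  | zero => exact other ψ hψ
  | succ n ih =>
    rw [Function.iterate_succ_apply']
    exact same _ (mem_prenex_succ.2 ⟨n, ψ, hψ, rfl⟩) ih

theorem Fml.quant_subst (b : Bool) (φ : Fml) (σ : ℕ → Tm) :
    (φ.quant b).subst σ = (φ.subst (lift σ)).quant b := by
  cases b <;> rfl

theorem Fml.FV_quant (b : Bool) (φ : Fml) : (φ.quant b).FV = {n | n + 1 ∈ φ.FV} := by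
  cases b <;> rfl

theorem Fml.QF.subst {φ : Fml} (h : φ.QF) (σ : ℕ → Tm) : (φ.subst σ).QF := by
  induction φ with
  | bot => trivial
  | eq s t => trivial
  | and φ ψ ih ih' | or φ ψ ih ih' | imp φ ψ ih ih' => exact ⟨ih h.1, ih' h.2⟩
  | all φ ih | ex φ ih => exact h.elim

theorem subst_mem_prenex {b : Bool} {k : ℕ} {φ : Fml} (h : φ ∈ prenex b k) (σ : ℕ → Tm) :
    φ.subst σ ∈ prenex b k := by
  induction k generalizing b φ σ with
  | zero => exact mem_prenex_zero.2 ((mem_prenex_zero.1 h).subst σ)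
  | succ k ih =>
    revert σ
    refine prenex_succ_induction (P := fun φ => ∀ σ, φ.subst σ ∈ prenex b (k + 1)) ?_ ?_ φ h
    · intro φ hφ σ
      rw [Fml.quant_subst]
      exact quant_mem_prenex_of_other (ih hφ _)
    · intro φ _ ih' σ
      rw [Fml.quant_subst]
      exact quant_mem_prenex (ih' _)

/-! ### Alternation paths -/

theorem alt_subst (φ : Fml) (σ : ℕ → Tm) : alt (φ.subst σ) = alt φ := by
  induction φ generalizing σ with
  | bot => rfl
  | eq s t => rfl
  | and φ ψ h h' | or φ ψ h h' => simp only [Fml.subst, alt, h, h']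
  | imp φ ψ h h' =>
    -- A negation has a clause of its own in the definition of `alt`.
    cases ψ with
    | bot => simp only [Fml.subst, alt, h]
    | eq | and | or | imp | all | ex =>
      exact congrArg₂ (· ∪ ·) (congrArg (Finset.image switchSigns) (h σ)) (h' σ)
  | all φ h | ex φ h => simp only [Fml.subst, alt, h]

/-- All alternation paths of `φ` have length at most `k`, and those of length `k` do not begin with
the sign opposite to `b`. -/
def SignBounded (b : Bool) (k : ℕ) (φ : Fml) : Prop :=
  ∀ s ∈ alt φ, s.length ≤ k ∧ (s.length = k → s.head? ≠ some !b)

theorem degree_le_iff {φ : Fml} {k : ℕ} : degree φ ≤ k ↔ ∀ s ∈ alt φ, s.length ≤ k := by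
  simp [degree]

theorem mem_iUnion_FClass {φ : Fml} {k : ℕ} : (φ ∈ ⋃ i < k, FClass i) ↔ degree φ < k := by
  simp [FClass]

/-- A path of positive length begins with one of the two signs, so beginning with `b` amounts to not
beginning with the opposite sign. -/
theorem degree_cases_iff_signBounded {φ : Fml} {k : ℕ} {b : Bool} :
    ((degree φ = k + 1 ∧ ∀ s ∈ alt φ, s.length = k + 1 → s.head? = some b) ∨ degree φ < k + 1) ↔
      SignBounded b (k + 1) φ := by
  have key (s : List Bool) (h : s.length = k + 1) : s.head? = some b ↔ s.head? ≠ some !b := by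
    cases s with
    | nil => simp at h
    | cons a s => cases a <;> cases b <;> simp
  constructor
  · rintro (⟨h, h'⟩ | h) s hs
    · exact ⟨degree_le_iff.1 h.le s hs, fun e => (key s e).1 (h' s hs e)⟩
    · have := degree_le_iff.1 (Nat.lt_succ_iff.1 h) s hs
      exact ⟨by omega, fun e => by omega⟩
  · intro h
    rcases (degree_le_iff.2 fun s hs => (h s hs).1).lt_or_eq with h' | h'
    · exact Or.inr h'
    · exact Or.inl ⟨h', fun s hs e => (key s e).2 ((h s hs).2 e)⟩

theorem degree_eq_zero_iff_signBounded {φ : Fml} {b : Bool} :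
    degree φ = 0 ↔ SignBounded b 0 φ := by
  rw [← Nat.le_zero, degree_le_iff]
  refine forall₂_congr fun s _ => ⟨fun h => ⟨h, fun e => ?_⟩, fun h => h.1⟩
  simp [List.length_eq_zero_iff.1 e]

theorem mem_EPlus_iff {φ : Fml} {k : ℕ} : φ ∈ EPlus k ↔ SignBounded true k φ := by
  cases k with
  | zero =>
    rw [← degree_eq_zero_iff_signBounded]
    simp [EPlus, EClass, FClass]
  | succ k =>
    rw [← degree_cases_iff_signBounded, EPlus, Set.mem_union, mem_iUnion_FClass]
    rfl

theorem mem_UPlus_iff {φ : Fml} {k : ℕ} : φ ∈ UPlus k ↔ SignBounded false k φ := by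
  cases k with
  | zero =>
    rw [← degree_eq_zero_iff_signBounded]
    simp [UPlus, UClass, FClass]
  | succ k =>
    rw [← degree_cases_iff_signBounded, UPlus, Set.mem_union, mem_iUnion_FClass]
    rfl

theorem alt_quant (b : Bool) (φ : Fml) : alt (φ.quant b) = (alt φ).image (prependSign b) := by
  cases b <;> rfl

theorem head?_prependSign (b : Bool) (s : List Bool) : (prependSign b s).head? = some b := by
  unfold prependSign
  split_ifs with h
  · exact h
  · rfl

theorem alt_nonempty (φ : Fml) : (alt φ).Nonempty := by
  induction φ with
  | bot => exact ⟨[], by simp [alt]⟩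
  | eq s t => exact ⟨[], by simp [alt]⟩
  | and φ ψ h _ | or φ ψ h _ => exact h.mono (Finset.subset_union_left)
  | imp φ ψ h _ =>
    cases ψ with
    | bot => exact h.image _
    | eq | and | or | imp | all | ex => exact (h.image _).mono Finset.subset_union_left
  | all φ h | ex φ h => exact h.image _

namespace SignBounded

variable {b : Bool} {k : ℕ} {φ ψ : Fml}

theorem subst (h : SignBounded b k φ) (σ : ℕ → Tm) : SignBounded b k (φ.subst σ) := by
  rwa [SignBounded, alt_subst]

theorem and_iff : SignBounded b k (Fml.and φ ψ) ↔ SignBounded b k φ ∧ SignBounded b k ψ := by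
  simp only [SignBounded, alt, Finset.mem_union, or_imp, forall_and]
  tauto

theorem or_iff : SignBounded b k (Fml.or φ ψ) ↔ SignBounded b k φ ∧ SignBounded b k ψ :=
  and_iff

theorem imp_left (h : SignBounded b k (Fml.imp φ ψ)) : SignBounded (!b) k φ := by
  intro s hs
  have hmem : switchSigns s ∈ alt (Fml.imp φ ψ) := by
    cases ψ with
    | bot => exact Finset.mem_image_of_mem _ hs
    | eq | and | or | imp | all | ex =>
      exact Finset.mem_union_left _ (Finset.mem_image_of_mem _ hs)
  have := h _ hmem
  simp only [switchSigns, List.length_map] at this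
  refine ⟨this.1, fun e e' => this.2 e ?_⟩
  rw [List.head?_map, e']
  simp

theorem imp_right (h : SignBounded b k (Fml.imp φ ψ)) : SignBounded b k ψ := by
  cases ψ with
  | bot =>
    intro s hs
    rw [Finset.mem_singleton.1 hs]
    simp
  | eq | and | or | imp | all | ex =>
    exact fun s hs => h s (Finset.mem_union_right _ hs)

theorem of_quant (h : SignBounded b k (φ.quant b)) : SignBounded b k φ := by
  intro s hs
  have := h _ (by rw [alt_quant]; exact Finset.mem_image_of_mem _ hs)
  unfold prependSign at this
  split_ifs at this with h'
  · exact this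
  · have := this.1
    simp only [List.length_cons] at this
    exact ⟨by omega, fun e => by omega⟩

/-- If a formula begins with the quantifier of the wrong sign, all of its paths begin with that
sign, so none of them has the maximal length. -/
theorem quant_not (h : SignBounded b (k + 1) (φ.quant !b)) : SignBounded (!b) k (φ.quant !b) := by
  intro s hs
  have hh : s.head? = some !b := by
    rw [alt_quant] at hs
    obtain ⟨s, _, rfl⟩ := Finset.mem_image.1 hs
    exact head?_prependSign _ _
  obtain ⟨h₁, h₂⟩ := h s hs
  have : s.length ≠ k + 1 := fun e => h₂ e hh
  exact ⟨by omega, fun _ => by rw [hh]; simp⟩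

/-- Every path of a quantified formula is non-empty. -/
theorem not_quant_zero {c : Bool} : ¬ SignBounded b 0 (φ.quant c) := by
  intro h
  obtain ⟨s, hs⟩ := alt_nonempty φ
  have := h _ (by rw [alt_quant]; exact Finset.mem_image_of_mem _ hs)
  have e := head?_prependSign c s
  rw [List.length_eq_zero_iff.1 (Nat.le_zero.1 this.1)] at e
  simp at e

theorem qf (h : SignBounded b 0 φ) : φ.QF := by
  induction φ generalizing b with
  | bot => trivial
  | eq s t => trivial
  | and φ ψ ih ih' => exact ⟨ih (and_iff.1 h).1, ih' (and_iff.1 h).2⟩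
  | or φ ψ ih ih' => exact ⟨ih (or_iff.1 h).1, ih' (or_iff.1 h).2⟩
  | imp φ ψ ih ih' => exact ⟨ih h.imp_left, ih' h.imp_right⟩
  | all φ _ => exact (not_quant_zero (c := false) h).elim
  | ex φ _ => exact (not_quant_zero (c := true) h).elim

end SignBounded

/-! ### Provable equivalence -/

/-- Provable equivalence of formulas. -/
def Equiv (T : Set Fml) (φ ψ : Fml) : Prop := Provable T (Fml.iff φ ψ)

/-- `φ` is stable if `T` proves `¬¬ φ → φ`. -/
def Stable (T : Set Fml) (φ : Fml) : Prop := Provable T (Fml.imp φ.nn φ)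

open Derives

section Logic

variable {T : Set Fml} {Γ : List Fml} {φ ψ χ φ' ψ' : Fml}

namespace Equiv

theorem intro (h : Derives T [φ] ψ) (h' : Derives T [ψ] φ) : Equiv T φ ψ :=
  andI (impI h) (impI h')

theorem mp (h : Equiv T φ ψ) (h' : Derives T Γ φ) : Derives T Γ ψ :=
  impE (andE₁ (of_provable h)) h'

theorem mpr (h : Equiv T φ ψ) (h' : Derives T Γ ψ) : Derives T Γ φ :=
  impE (andE₂ (of_provable h)) h'

theorem refl (φ : Fml) : Equiv T φ φ := intro h0 h0

theorem symm (h : Equiv T φ ψ) : Equiv T ψ φ := intro (h.mpr h0) (h.mp h0)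

theorem trans (h : Equiv T φ ψ) (h' : Equiv T ψ χ) : Equiv T φ χ :=
  intro (h'.mp (h.mp h0)) (h.mpr (h'.mpr h0))

theorem and (h : Equiv T φ φ') (h' : Equiv T ψ ψ') :
    Equiv T (Fml.and φ ψ) (Fml.and φ' ψ') :=
  intro (andI (h.mp (andE₁ h0)) (h'.mp (andE₂ h0)))
    (andI (h.mpr (andE₁ h0)) (h'.mpr (andE₂ h0)))

theorem or (h : Equiv T φ φ') (h' : Equiv T ψ ψ') :
    Equiv T (Fml.or φ ψ) (Fml.or φ' ψ') :=
  intro (orE h0 (orI₁ (h.mp h0)) (orI₂ (h'.mp h0)))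
    (orE h0 (orI₁ (h.mpr h0)) (orI₂ (h'.mpr h0)))

theorem imp (h : Equiv T φ φ') (h' : Equiv T ψ ψ') :
    Equiv T (Fml.imp φ ψ) (Fml.imp φ' ψ') :=
  intro (impI (h'.mp (impE h1 (h.mpr h0)))) (impI (h'.mpr (impE h1 (h.mp h0))))

theorem quant (b : Bool) (h : Equiv T φ ψ) : Equiv T (φ.quant b) (ψ.quant b) :=
  match b with
  | true => intro (exE h0 (exI_shift (h.mp h0))) (exE h0 (exI_shift (h.mpr h0)))
  | false => intro (allI (h.mp (allE_shift h0))) (allI (h.mpr (allE_shift h0)))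

theorem and_comm (φ ψ : Fml) : Equiv T (Fml.and φ ψ) (Fml.and ψ φ) :=
  intro (andI (andE₂ h0) (andE₁ h0)) (andI (andE₂ h0) (andE₁ h0))

theorem or_comm (φ ψ : Fml) : Equiv T (Fml.or φ ψ) (Fml.or ψ φ) :=
  intro (orE h0 (orI₂ h0) (orI₁ h0)) (orE h0 (orI₂ h0) (orI₁ h0))

/-- A vacuous quantifier may be added. -/
theorem quant_shift (b : Bool) (φ : Fml) : Equiv T φ (φ.shift.quant b) :=
  match b with
  | true => intro (exI (Tm.v 0) (by rw [Fml.shift_inst]; exact h0)) (exE h0 h0)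
  | false => intro (allI h0) (by
      have : Derives T [φ.shift.all] (φ.shift.inst (Tm.v 0)) := allE (Tm.v 0) h0
      rwa [Fml.shift_inst] at this)

theorem quant_and (b : Bool) (φ ψ : Fml) :
    Equiv T (Fml.and (φ.quant b) ψ) ((Fml.and φ ψ.shift).quant b) :=
  match b with
  | true => intro (exE (andE₁ h0) (exI_shift (andI h0 (andE₂ h1))))
      (exE h0 (andI (exI_shift (andE₁ h0)) (andE₂ h0)))
  | false => intro (allI (andI (allE_shift (andE₁ h0)) (andE₂ h0)))
      (andI (allI (andE₁ (allE_shift h0))) (by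
        have : Derives T [(Fml.and φ ψ.shift).all] (ψ.shift.inst (Tm.v 0)) :=
          andE₂ (allE (Tm.v 0) h0)
        rwa [Fml.shift_inst] at this))

theorem or_ex (φ ψ : Fml) : Equiv T (Fml.or φ.ex ψ) (Fml.or φ ψ.shift).ex :=
  intro (orE h0 (exE h0 (exI_shift (orI₁ h0))) (exI (Tm.v 0) (orI₂ (by
      change Derives _ _ (ψ.shift.inst (Tm.v 0))
      rw [Fml.shift_inst]
      exact h0))))
    (exE h0 (orE h0 (orI₁ (exI_shift h0)) (orI₂ h0)))

/-- A premise that is decidable may be moved under either quantifier. -/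
theorem imp_quant (b : Bool) (h : Provable T (Fml.or ψ ψ.neg)) :
    Equiv T (Fml.imp ψ (φ.quant b)) ((Fml.imp ψ.shift φ).quant b) :=
  match b with
  | true => intro
      (orE (of_provable h) (exE (impE h1 h0) (exI_shift (impI h1)))
        (exI (Tm.v 0) (by
          change Derives _ _ (Fml.imp (ψ.shift.inst (Tm.v 0)) (φ.inst (Tm.v 0)))
          rw [Fml.shift_inst]
          exact impI (botE (impE h1 h0)))))
      (exE h0 (impI (exI_shift (impE h1 h0))))
  | false => intro (allI (impI (allE_shift (impE h1 h0))))
      (impI (allI (impE (allE_shift h1) h0)))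

theorem neg_or (φ ψ : Fml) : Equiv T (Fml.or φ ψ).neg (Fml.and φ.neg ψ.neg) :=
  intro (andI (impI (impE h1 (orI₁ h0))) (impI (impE h1 (orI₂ h0))))
    (impI (orE h0 (impE (andE₁ h2) h0) (impE (andE₂ h2) h0)))

theorem neg_ex (φ : Fml) : Equiv T φ.ex.neg φ.neg.all :=
  intro (allI (impI (impE h1 (exI_shift h0)))) (impI (exE h0 (impE (allE_shift h2) h0)))

end Equiv

namespace Stable

theorem by_contra (h : Stable T φ) (h' : Derives T (φ.neg :: Γ) Fml.bot) : Derives T Γ φ :=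
  impE (of_provable h) (impI h')

theorem congr (h : Stable T φ) (e : Equiv T φ ψ) : Stable T ψ :=
  impI (e.mp (h.by_contra (impE h1 (impI (impE h1 (e.mpr h0))))))

theorem of_or_self (h : Stable T (Fml.or φ φ)) : Stable T φ :=
  h.congr (.intro (orE h0 h0 h0) (orI₁ h0))

theorem imp_equiv (h : Stable T (Fml.or φ.neg ψ)) :
    Equiv T (Fml.imp φ ψ) (Fml.or φ.neg ψ) :=
  .intro (h.by_contra (impE h0 (orI₁ (impI (impE h1 (orI₂ (impE h2 h0)))))))
    (impI (orE h1 (botE (impE h0 h1)) h0))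

theorem neg_and_equiv (h : Stable T (Fml.or φ.neg ψ.neg)) :
    Equiv T (Fml.and φ ψ).neg (Fml.or φ.neg ψ.neg) :=
  .intro (h.by_contra (impE h0 (orI₁ (impI (impE h1 (orI₂ (impI (impE h3 (andI h1 h0)))))))))
    (orE h0 (impI (impE h1 (andE₁ h0))) (impI (impE h1 (andE₂ h0))))

theorem neg_imp_equiv (h : Stable T φ) :
    Equiv T (Fml.imp φ ψ).neg (Fml.and φ ψ.neg) :=
  .intro (andI (h.by_contra (impE h1 (impI (botE (impE h1 h0))))) (impI (impE h1 (impI h1))))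
    (impI (impE (andE₂ h1) (impE h0 (andE₁ h1))))

/-- Double negation shift for `φ` moves a negation inside a universal quantifier. -/
theorem neg_all_equiv (hs : Provable T (Fml.imp φ.nn.all φ.all.nn)) (h : Stable T φ.neg.ex) :
    Equiv T φ.all.neg φ.neg.ex :=
  .intro (h.by_contra
      (impE (impE (of_provable hs) (allI (impI (impE h1 (exI_shift h0))))) h1))
    (exE h0 (impI (impE h1 (allE_shift h0))))

/-- If `x` is not free in `ψ`, then `∀ x (φ ∨ ψ)` yields `¬¬ (∀ x φ ∨ ψ)`: if `ψ` fails, then `φ`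
holds for all `x`. -/
theorem or_all_equiv (h : Stable T (Fml.or φ.all ψ)) :
    Equiv T (Fml.or φ.all ψ) (Fml.or φ ψ.shift).all :=
  .intro (allI (orE h0 (orI₁ (allE_shift h0)) (orI₂ h0)))
    (h.by_contra (impE h0 (orI₁ (allI (orE (allE_shift h1) h0 (botE (impE h1 (orI₂ h0))))))))

end Stable

end Logic

/-! ### Induction and the decidability of `t = 0` -/

namespace Tm

@[simp] theorem zero_subst (σ : ℕ → Tm) : Tm.zero.subst σ = Tm.zero :=
  congrArg (Tm.app PRSymb.zero) (funext fun i => i.elim0)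

@[simp] theorem succ_subst (t : Tm) (σ : ℕ → Tm) :
    (Tm.succ t).subst σ = Tm.succ (t.subst σ) := rfl

@[simp] theorem zero_varFinset : Tm.zero.varFinset = ∅ := rfl

end Tm

section Arithmetic

variable {T : Set Fml} {Γ : List Fml}

theorem Derives.ha (hT : HA ⊆ T) {φ : Fml} (h : HAAxiom φ) : Derives T Γ φ := ax (hT h)

theorem Derives.induction (hT : HA ⊆ T) {φ : Fml} (t : Tm)
    (zero : Derives T Γ (φ.inst Tm.zero))
    (succ : Derives T (φ :: Γ.map Fml.shift) φ.instSucc) : Derives T Γ (φ.inst t) :=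
  allE t (impE (ha hT (.induction φ)) (andI zero (allI (impI succ))))

theorem eq_zero_or_ne (hT : HA ⊆ T) (t : Tm) :
    Derives T Γ (Fml.or (Fml.eq t Tm.zero) (Fml.eq t Tm.zero).neg) := by
  have := induction (Γ := Γ) hT
    (φ := Fml.or (Fml.eq (Tm.v 0) Tm.zero) (Fml.eq (Tm.v 0) Tm.zero).neg) t
  simp only [Fml.inst, Fml.instSucc, Fml.subst, Fml.neg, Language.Term.subst, Tm.zero_subst,
    scons_zero] at this
  exact this (orI₁ (eqRefl _)) (orI₂ (ha hT (.succ_ne_zero _)))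

/-- A disjunction is an existential statement whose witness says which disjunct holds. -/
theorem Equiv.or_ex_eq_zero (hT : HA ⊆ T) (φ ψ : Fml) :
    Equiv T (Fml.or φ ψ) (Fml.and (Fml.imp (Fml.eq (Tm.v 0) Tm.zero) φ.shift)
      (Fml.imp (Fml.eq (Tm.v 0) Tm.zero).neg ψ.shift)).ex := by
  have e (t : Tm) : (Fml.and (Fml.imp (Fml.eq (Tm.v 0) Tm.zero) φ.shift)
      (Fml.imp (Fml.eq (Tm.v 0) Tm.zero).neg ψ.shift)).inst t =
      Fml.and (Fml.imp (Fml.eq t Tm.zero) φ) (Fml.imp (Fml.eq t Tm.zero).neg ψ) := by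
    change Fml.and (Fml.imp (Fml.eq t (Tm.zero.subst _)) (φ.shift.inst t))
      (Fml.imp (Fml.eq t (Tm.zero.subst _)).neg (ψ.shift.inst t)) = _
    simp
  refine .intro (orE h0 (exI Tm.zero ?_) (exI (Tm.succ Tm.zero) ?_)) (exE h0 ?_)
  · rw [e]
    exact andI (impI h1) (impI (botE (impE h0 (eqRefl _))))
  · rw [e]
    exact andI (impI (botE (impE (ha hT (.succ_ne_zero _)) h0))) (impI h1)
  · exact orE (eq_zero_or_ne hT (Tm.v 0)) (orI₁ (impE (andE₁ h1) h0))
      (orI₂ (impE (andE₂ h1) h0))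

end Arithmetic

/-! ### Formulas equivalent to prenex formulas -/

/-- `φ` is equivalent in `T` to a formula of the class `prenex b k` with the same free
variables. -/
def Rep (T : Set Fml) (b : Bool) (k : ℕ) (φ : Fml) : Prop :=
  ∃ φ' ∈ prenex b k, φ.FV = φ'.FV ∧ Equiv T φ φ'

namespace Rep

variable {T : Set Fml} {b : Bool} {k : ℕ} {φ ψ : Fml}

theorem of_mem (h : φ ∈ prenex b k) : Rep T b k φ := ⟨φ, h, rfl, .refl φ⟩

theorem of_equiv (h : Rep T b k ψ) (e : Equiv T φ ψ) (hv : φ.FV = ψ.FV) : Rep T b k φ := by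
  obtain ⟨χ, hχ, hv', e'⟩ := h
  exact ⟨χ, hχ, hv.trans hv', e.trans e'⟩

theorem quant_other (h : Rep T (!b) k φ) : Rep T b (k + 1) (φ.quant b) := by
  obtain ⟨χ, hχ, hv, e⟩ := h
  exact ⟨χ.quant b, quant_mem_prenex_of_other hχ, by rw [Fml.FV_quant, Fml.FV_quant, hv],
    e.quant b⟩

theorem quant_same (h : Rep T b (k + 1) φ) : Rep T b (k + 1) (φ.quant b) := by
  obtain ⟨χ, hχ, hv, e⟩ := h
  exact ⟨χ.quant b, quant_mem_prenex hχ, by rw [Fml.FV_quant, Fml.FV_quant, hv], e.quant b⟩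

theorem succ_of_other (h : Rep T (!b) k φ) : Rep T b (k + 1) φ := by
  obtain ⟨χ, hχ, hv, e⟩ := h
  refine of_equiv (of_mem (quant_mem_prenex_of_other (subst_mem_prenex hχ _)))
    (e.trans (.quant_shift b χ)) ?_
  rw [hv, Fml.FV_quant]
  ext n
  exact Fml.succ_mem_FV_shift.symm

/-- The vacuous quantifier is added as the innermost one. -/
theorem succ (h : Rep T b k φ) : Rep T b (k + 1) φ := by
  induction k generalizing b φ with
  | zero =>
    obtain ⟨χ, hχ, hv, e⟩ := h
    rw [mem_prenex_zero] at hχ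
    exact succ_of_other ⟨χ, mem_prenex_zero.2 hχ, hv, e⟩
  | succ k ih =>
    obtain ⟨χ, hχ, hv, e⟩ := h
    refine of_equiv ?_ e hv
    exact prenex_succ_induction (P := Rep T b (k + 1 + 1))
      (fun φ hφ => (ih (of_mem hφ)).quant_other) (fun φ _ h => h.quant_same) χ hχ

theorem of_QF (h : φ.QF) : Rep T b k φ := by
  induction k with
  | zero => exact of_mem (mem_prenex_zero.2 h)
  | succ k ih => exact ih.succ

/-- A binary connective preserves a prenex class as soon as the leading quantifiers of that class
can be moved across it. -/
theorem closure_of_quant {op : Fml → Fml → Fml}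
    (hv : ∀ φ ψ, (op φ ψ).FV = φ.FV ∪ ψ.FV) (comm : ∀ φ ψ, Equiv T (op φ ψ) (op ψ φ))
    (pull : ∀ φ ∈ prenex (!b) k ∪ prenex b (k + 1), ∀ ψ ∈ prenex (!b) k ∪ prenex b (k + 1),
      Equiv T (op (φ.quant b) ψ) ((op φ ψ.shift).quant b))
    (base : ∀ φ ∈ prenex (!b) k, ∀ ψ ∈ prenex (!b) k, Rep T b (k + 1) (op φ ψ)) :
    ∀ φ ∈ prenex b (k + 1), ∀ ψ ∈ prenex b (k + 1), Rep T b (k + 1) (op φ ψ) := by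
  have swap {φ ψ} (h : Rep T b (k + 1) (op ψ φ)) : Rep T b (k + 1) (op φ ψ) :=
    h.of_equiv (comm φ ψ) (by rw [hv, hv, Set.union_comm])
  have step {φ ψ} (hφ : φ ∈ prenex (!b) k ∪ prenex b (k + 1))
      (hψ : ψ ∈ prenex (!b) k ∪ prenex b (k + 1)) (h : Rep T b (k + 1) (op φ ψ.shift)) :
      Rep T b (k + 1) (op (φ.quant b) ψ) := by
    refine h.quant_same.of_equiv (pull φ hφ ψ hψ) ?_
    ext n
    simp [hv, Fml.FV_quant]
  have half : ∀ ψ ∈ prenex b (k + 1), ∀ φ ∈ prenex (!b) k, Rep T b (k + 1) (op ψ φ) :=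
    prenex_succ_induction
      (fun ψ hψ φ hφ => step (.inl hψ) (.inl hφ) (base _ hψ _ (subst_mem_prenex hφ _)))
      (fun ψ hψ ih φ hφ => step (.inr hψ) (.inl hφ) (ih _ (subst_mem_prenex hφ _)))
  exact prenex_succ_induction
    (fun φ hφ ψ hψ => step (.inl hφ) (.inr hψ) (swap (half _ (subst_mem_prenex hψ _) _ hφ)))
    (fun φ hφ ih ψ hψ => step (.inr hφ) (.inr hψ) (ih _ (subst_mem_prenex hψ _)))

theorem and_of_mem :
    ∀ φ ∈ prenex b k, ∀ ψ ∈ prenex b k, Rep T b k (Fml.and φ ψ) := by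
  induction k generalizing b with
  | zero =>
    exact fun φ hφ ψ hψ => of_QF ⟨mem_prenex_zero.1 hφ, mem_prenex_zero.1 hψ⟩
  | succ k ih =>
    exact closure_of_quant (fun _ _ => rfl) .and_comm (fun φ _ ψ _ => .quant_and b φ ψ)
      fun φ hφ ψ hψ => (ih φ hφ ψ hψ).succ_of_other

theorem and (h : Rep T b k φ) (h' : Rep T b k ψ) : Rep T b k (Fml.and φ ψ) := by
  obtain ⟨χ, hχ, hv, e⟩ := h
  obtain ⟨χ', hχ', hv', e'⟩ := h'
  exact (and_of_mem χ hχ χ' hχ').of_equiv (e.and e') (by simp only [Fml.FV, hv, hv'])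

/-- Decidability is required of all substitution instances of `ψ`, because `ψ` is shifted under the
quantifiers of `φ`. -/
theorem imp_of_decidable (hq : ψ.QF) (hd : ∀ σ, Provable T (Fml.or (ψ.subst σ) (ψ.subst σ).neg))
    (h : Rep T b k φ) : Rep T b k (Fml.imp ψ φ) := by
  obtain ⟨χ, hχ, hv, e⟩ := h
  refine of_equiv ?_ ((Equiv.refl ψ).imp e) (by simp only [Fml.FV, hv])
  clear hv e
  induction k generalizing b χ ψ with
  | zero => exact of_QF ⟨hq, mem_prenex_zero.1 hχ⟩
  | succ k ih =>
    have hd' (ψ : Fml) (hd : ∀ σ, Provable T (Fml.or (ψ.subst σ) (ψ.subst σ).neg)) :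
        (∀ σ, Provable T (Fml.or (ψ.shift.subst σ) (ψ.shift.subst σ).neg)) := by
      intro σ
      rw [Fml.shift, Fml.subst_subst]
      exact hd _
    have step (ψ χ : Fml) (hd : ∀ σ, Provable T (Fml.or (ψ.subst σ) (ψ.subst σ).neg))
        (h : Rep T b (k + 1) ((Fml.imp ψ.shift χ).quant b)) :
        Rep T b (k + 1) (Fml.imp ψ (χ.quant b)) := by
      refine h.of_equiv (.imp_quant b ?_) ?_
      · have := hd Tm.v
        rwa [Fml.subst_v] at this
      · ext n
        simp [Fml.FV, Fml.FV_quant]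
    revert ψ
    refine prenex_succ_induction (P := fun χ => ∀ {ψ : Fml}, ψ.QF →
      (∀ σ, Provable T (Fml.or (ψ.subst σ) (ψ.subst σ).neg)) → Rep T b (k + 1) (Fml.imp ψ χ))
      (fun χ hχ ψ hq hd => ?_) (fun χ _ ih' ψ hq hd => ?_) χ hχ
    · exact step ψ χ hd (ih (hq.subst _) (hd' ψ hd) χ hχ).quant_other
    · exact step ψ χ hd (ih' (hq.subst _) (hd' ψ hd)).quant_same

/-- A disjunction of two `Π_k` formulas is equivalent to a `Σ_{k+1}` formula. -/
theorem or_of_pi (hT : HA ⊆ T) (h : Rep T false k φ) (h' : Rep T false k ψ) :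
    Rep T true (k + 1) (Fml.or φ ψ) := by
  obtain ⟨χ, hχ, hv, e⟩ := h
  obtain ⟨χ', hχ', hv', e'⟩ := h'
  have hd (σ : ℕ → Tm) : Provable T (Fml.or ((Fml.eq (Tm.v 0) Tm.zero).subst σ)
      ((Fml.eq (Tm.v 0) Tm.zero).subst σ).neg) := by
    simp only [Fml.subst, Tm.zero_subst]
    exact eq_zero_or_ne hT _
  have hn (σ : ℕ → Tm) : Provable T (Fml.or ((Fml.eq (Tm.v 0) Tm.zero).neg.subst σ)
      ((Fml.eq (Tm.v 0) Tm.zero).neg.subst σ).neg) :=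
    orE (hd σ) (orI₂ (impI (impE h0 h1))) (orI₁ h0)
  refine of_equiv (quant_other (b := true) (k := k) (and
    (imp_of_decidable (ψ := Fml.eq (Tm.v 0) Tm.zero) trivial hd (of_mem (subst_mem_prenex hχ _)))
    (imp_of_decidable (ψ := (Fml.eq (Tm.v 0) Tm.zero).neg) ⟨trivial, trivial⟩ hn
      (of_mem (subst_mem_prenex hχ' _)))))
    ((e.or e').trans (.or_ex_eq_zero hT χ χ')) ?_
  rw [Fml.FV_quant]
  ext n
  have hs (θ : Fml) : n + 1 ∈ (θ.subst fun m => Tm.v (m + 1)).FV ↔ n ∈ θ.FV :=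
    Fml.succ_mem_FV_shift
  simp [Fml.FV, Fml.neg, hv, hv', hs]

/-- Leading existential quantifiers move across the disjunction by pure logic; what is left is a
disjunction of `Π_k` formulas. -/
theorem or_sigma (hT : HA ⊆ T) (h : Rep T true (k + 1) φ) (h' : Rep T true (k + 1) ψ) :
    Rep T true (k + 1) (Fml.or φ ψ) := by
  obtain ⟨χ, hχ, hv, e⟩ := h
  obtain ⟨χ', hχ', hv', e'⟩ := h'
  refine of_equiv ?_ (e.or e') (by simp only [Fml.FV, hv, hv'])
  exact closure_of_quant (fun _ _ => rfl) .or_comm (fun φ _ ψ _ => .or_ex φ ψ)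
    (fun φ hφ ψ hψ => or_of_pi hT (of_mem hφ) (of_mem hψ)) χ hχ χ' hχ'

end Rep

/-! ### Induction on formulas -/

/-- `T` proves `Σ_k`-DNE and `U_k^+`-DNS, with arbitrarily many parameters. -/
structure ProvesDNEAndDNS (T : Set Fml) (k : ℕ) : Prop where
  dne : ∀ φ ∈ prenex true k, Stable T φ
  dns : ∀ φ, SignBounded false k φ → Provable T (Fml.imp φ.nn.all φ.all.nn)

/-- `T` proves `(Π_k ∨ Π_k)`-DNE, with arbitrarily many parameters. -/
def ProvesDNEOr (T : Set Fml) (k : ℕ) : Prop :=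
  ∀ φ ∈ prenex false k, ∀ ψ ∈ prenex false k, Stable T (Fml.or φ ψ)

section

variable {T : Set Fml} {b : Bool} {k : ℕ} {φ ψ : Fml}

theorem Stable.of_rep (h : ∀ φ ∈ prenex b k, Stable T φ) (hφ : Rep T b k φ) : Stable T φ := by
  obtain ⟨χ, hχ, _, e⟩ := hφ
  exact (h χ hχ).congr e.symm

namespace ProvesDNEOr

theorem stable_or (h : ProvesDNEOr T k) (hφ : Rep T false k φ) (hψ : Rep T false k ψ) :
    Stable T (Fml.or φ ψ) := by
  obtain ⟨χ, hχ, _, e⟩ := hφ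
  obtain ⟨χ', hχ', _, e'⟩ := hψ
  exact (h χ hχ χ' hχ').congr (e.symm.or e'.symm)

theorem stable (h : ProvesDNEOr T k) (hφ : Rep T false k φ) : Stable T φ :=
  (h.stable_or hφ hφ).of_or_self

/-- Universal quantifiers move across the disjunction by stability; what is left is a disjunction of
`Σ_k` formulas. -/
theorem rep_or (hT : HA ⊆ T) (h : ProvesDNEOr T (k + 1)) (hφ : Rep T false (k + 1) φ)
    (hψ : Rep T false (k + 1) ψ) : Rep T false (k + 1) (Fml.or φ ψ) := by
  obtain ⟨χ, hχ, hv, e⟩ := hφ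
  obtain ⟨χ', hχ', hv', e'⟩ := hψ
  refine Rep.of_equiv ?_ (e.or e') (by simp only [Fml.FV, hv, hv'])
  refine Rep.closure_of_quant (fun _ _ => rfl) .or_comm (fun φ hφ ψ hψ => ?_) (fun φ hφ ψ hψ => ?_)
    χ hχ χ' hχ'
  · refine (h.stable_or (φ := φ.all) (ψ := ψ) ?_ ?_).or_all_equiv
    · rcases hφ with hφ | hφ
      · exact (Rep.of_mem hφ).quant_other (b := false)
      · exact (Rep.of_mem hφ).quant_same (b := false)
    · rcases hψ with hψ | hψ
      · exact (Rep.of_mem hψ).succ_of_other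
      · exact .of_mem hψ
  · cases k with
    | zero => exact .of_QF ⟨mem_prenex_zero.1 hφ, mem_prenex_zero.1 hψ⟩
    | succ k => exact (Rep.or_sigma hT (.of_mem hφ) (.of_mem hψ)).succ_of_other

theorem pred (h : ProvesDNEOr T (k + 1)) : ProvesDNEOr T k :=
  fun _ hφ _ hψ => h.stable_or (Rep.of_mem hφ).succ (Rep.of_mem hψ).succ

end ProvesDNEOr

/-- A disjunction of two `Π_k` formulas is stable because it has a `Σ_{k+1}` form. -/
theorem ProvesDNEAndDNS.provesDNEOr (hT : HA ⊆ T) (h : ProvesDNEAndDNS T (k + 1)) :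
    ProvesDNEOr T k :=
  fun _ hφ _ hψ => Stable.of_rep h.dne (Rep.or_of_pi hT (.of_mem hφ) (.of_mem hψ))

/-- The induction steps at the propositional connectives, for a set `R` of stable formulas that is
closed under conjunction, disjunction and equivalence. They are the same for `Σ_k` and for `Π_k`. -/
theorem connective_steps {R : Fml → Prop} (stable : ∀ {φ}, R φ → Stable T φ)
    (of_equiv : ∀ {φ ψ}, R ψ → Equiv T φ ψ → φ.FV = ψ.FV → R φ)
    (and : ∀ {φ ψ}, R φ → R ψ → R (Fml.and φ ψ)) (or : ∀ {φ ψ}, R φ → R ψ → R (Fml.or φ ψ))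
    (φ ψ : Fml) :
    (R φ.neg → R ψ.neg → R (Fml.and φ ψ).neg) ∧ (R φ.neg → R ψ.neg → R (Fml.or φ ψ).neg) ∧
      (R φ.neg → R ψ → R (Fml.imp φ ψ)) ∧ (R φ → R ψ.neg → R (Fml.imp φ ψ).neg) := by
  refine ⟨fun h h' => ?_, fun h h' => ?_, fun h h' => ?_, fun h h' => ?_⟩
  · exact of_equiv (or h h') (stable (or h h')).neg_and_equiv (by simp [Fml.FV, Fml.neg])
  · exact of_equiv (and h h') (.neg_or φ ψ) (by simp [Fml.FV, Fml.neg])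
  · exact of_equiv (or h h') (stable (or h h')).imp_equiv (by simp [Fml.FV, Fml.neg])
  · exact of_equiv (and h h') (stable h).neg_imp_equiv (by simp [Fml.FV, Fml.neg])

end

/-- The prenex normal form theorem at level `k`, together with the prenex normal forms of negated
formulas that the induction needs. -/
structure PrenexAt (k : ℕ) : Prop where
  sigma : ∀ {T : Set Fml}, HA ⊆ T → ProvesDNEAndDNS T k → ∀ φ : Fml,
    (SignBounded true k φ → Rep T true k φ) ∧ (SignBounded false k φ → Rep T true k φ.neg)
  pi : ∀ {T : Set Fml}, HA ⊆ T → ProvesDNEOr T k → ∀ φ : Fml,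
    (SignBounded false k φ → Rep T false k φ) ∧ (SignBounded true k φ → Rep T false k φ.neg)

theorem PrenexAt.zero : PrenexAt 0 :=
  ⟨fun _ _ _ => ⟨fun h => .of_QF h.qf, fun h => .of_QF ⟨h.qf, trivial⟩⟩,
    fun _ _ _ => ⟨fun h => .of_QF h.qf, fun h => .of_QF ⟨h.qf, trivial⟩⟩⟩

/-- One level up, `(Π_{k+1} ∨ Π_{k+1})`-DNE yields both principles of the `Σ_k` case: a `Σ_k`
formula is stable because it is `Π_{k+1}` up to a vacuous quantifier, and a `U_k^+` formula is
stable because it has a `Π_k` form. -/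
theorem ProvesDNEOr.provesDNEAndDNS {T : Set Fml} {k : ℕ} (hk : PrenexAt k) (hT : HA ⊆ T)
    (h : ProvesDNEOr T (k + 1)) : ProvesDNEAndDNS T k where
  dne φ hφ := h.stable (Rep.of_mem hφ).succ_of_other
  dns φ hφ := by
    have hs : Stable T φ := h.pred.stable ((hk.pi hT h.pred φ).1 hφ)
    exact .impI (.impI (.impE .h0 (.allI (hs.by_contra
      (.impE (Derives.allE_shift .h2) .h0)))))

theorem PrenexAt.succ {k : ℕ} (hk : PrenexAt k) : PrenexAt (k + 1) where
  sigma {T} hT h φ := by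
    have hOr : ProvesDNEOr T k := h.provesDNEOr hT
    have hst {φ : Fml} (hφ : Rep T true (k + 1) φ) : Stable T φ := .of_rep h.dne hφ
    have steps (φ ψ : Fml) := connective_steps (R := Rep T true (k + 1)) hst Rep.of_equiv Rep.and
      (Rep.or_sigma hT) φ ψ
    induction φ with
    | bot => exact ⟨fun _ => .of_QF trivial, fun _ => .of_QF ⟨trivial, trivial⟩⟩
    | eq s t => exact ⟨fun _ => .of_QF trivial, fun _ => .of_QF ⟨trivial, trivial⟩⟩
    | and φ ψ ih ih' =>
      simp only [SignBounded.and_iff]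
      exact ⟨fun H => .and (ih.1 H.1) (ih'.1 H.2),
        fun H => (steps φ ψ).1 (ih.2 H.1) (ih'.2 H.2)⟩
    | or φ ψ ih ih' =>
      simp only [SignBounded.or_iff]
      exact ⟨fun H => .or_sigma hT (ih.1 H.1) (ih'.1 H.2),
        fun H => (steps φ ψ).2.1 (ih.2 H.1) (ih'.2 H.2)⟩
    | imp φ ψ ih ih' =>
      exact ⟨fun H => (steps φ ψ).2.2.1 (ih.2 H.imp_left) (ih'.1 H.imp_right),
        fun H => (steps φ ψ).2.2.2 (ih.1 H.imp_left) (ih'.2 H.imp_right)⟩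
    | all φ ih =>
      refine ⟨fun H => ?_, fun H => ?_⟩
      · -- The quantifier has the wrong sign, so the formula is in `U_k^+`.
        have H' : SignBounded false k φ.all := H.quant_not (b := true) (φ := φ)
        exact ((hk.pi hT hOr φ.all).1 H').succ_of_other
      · have H' : SignBounded false (k + 1) φ := .of_quant (b := false) H
        have hr : Rep T true (k + 1) φ.neg.ex := (ih.2 H').quant_same
        exact hr.of_equiv ((hst hr).neg_all_equiv (h.dns φ H')) (by simp [Fml.FV, Fml.neg])
    | ex φ ih =>
      refine ⟨fun H => (ih.1 (.of_quant (b := true) H)).quant_same (b := true), fun H => ?_⟩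
      have H' : SignBounded true k φ.ex := H.quant_not (b := false) (φ := φ)
      exact ((hk.pi hT hOr φ.ex).2 H').succ_of_other
  pi {T} hT h φ := by
    have hSigma : ProvesDNEAndDNS T k := h.provesDNEAndDNS hk hT
    have steps (φ ψ : Fml) := connective_steps (R := Rep T false (k + 1)) h.stable Rep.of_equiv
      Rep.and (h.rep_or hT) φ ψ
    induction φ with
    | bot => exact ⟨fun _ => .of_QF trivial, fun _ => .of_QF ⟨trivial, trivial⟩⟩
    | eq s t => exact ⟨fun _ => .of_QF trivial, fun _ => .of_QF ⟨trivial, trivial⟩⟩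
    | and φ ψ ih ih' =>
      simp only [SignBounded.and_iff]
      exact ⟨fun H => .and (ih.1 H.1) (ih'.1 H.2),
        fun H => (steps φ ψ).1 (ih.2 H.1) (ih'.2 H.2)⟩
    | or φ ψ ih ih' =>
      simp only [SignBounded.or_iff]
      exact ⟨fun H => h.rep_or hT (ih.1 H.1) (ih'.1 H.2),
        fun H => (steps φ ψ).2.1 (ih.2 H.1) (ih'.2 H.2)⟩
    | imp φ ψ ih ih' =>
      exact ⟨fun H => (steps φ ψ).2.2.1 (ih.2 H.imp_left) (ih'.1 H.imp_right),
        fun H => (steps φ ψ).2.2.2 (ih.1 H.imp_left) (ih'.2 H.imp_right)⟩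
    | all φ ih =>
      refine ⟨fun H => (ih.1 (.of_quant (b := false) H)).quant_same (b := false), fun H => ?_⟩
      have H' : SignBounded false k φ.all := H.quant_not (b := true) (φ := φ)
      exact ((hk.sigma hT hSigma φ.all).2 H').succ_of_other
    | ex φ ih =>
      refine ⟨fun H => ?_, fun H => ?_⟩
      · -- The quantifier has the wrong sign, so the formula is in `E_k^+`.
        have H' : SignBounded true k φ.ex := H.quant_not (b := false) (φ := φ)
        exact ((hk.sigma hT hSigma φ.ex).1 H').succ_of_other
      · have hr : Rep T false (k + 1) φ.neg.all :=
          (ih.2 (.of_quant (b := true) H)).quant_same (b := false)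
        exact hr.of_equiv (.neg_ex φ) (by simp [Fml.FV, Fml.neg])

theorem prenexAt (k : ℕ) : PrenexAt k := by
  induction k with
  | zero => exact .zero
  | succ k ih => exact ih.succ

/-! ### Equational reasoning -/

section Equality

variable {T : Set Fml} {Γ : List Fml} {r s t s' t' : Tm}

namespace Tm

@[simp] theorem zero_relabel : Tm.zero.relabel Nat.succ = Tm.zero := by
  rw [relabel_eq_subst, zero_subst]

@[simp] theorem succ_relabel (t : Tm) :
    (Tm.succ t).relabel Nat.succ = Tm.succ (t.relabel Nat.succ) :=
  rfl

@[simp] theorem v_relabel (n : ℕ) : (Tm.v n).relabel Nat.succ = Tm.v (n + 1) := rfl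

@[simp] theorem subst_v_succ (t : Tm) : t.subst (fun n => Tm.v (n + 1)) = t.relabel Nat.succ :=
  (relabel_eq_subst _ _).symm

/-- The application of a unary function symbol. -/
def app₁ (f : PRSymb 1) (t : Tm) : Tm := Tm.app f ![t]

/-- The application of a binary function symbol. -/
def app₂ (f : PRSymb 2) (s t : Tm) : Tm := Tm.app f ![s, t]

@[simp] theorem app₁_subst (f : PRSymb 1) (t : Tm) (σ : ℕ → Tm) :
    (app₁ f t).subst σ = app₁ f (t.subst σ) :=
  congrArg (Tm.app f) (funext fun i => by fin_cases i; rfl)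

@[simp] theorem app₂_subst (f : PRSymb 2) (s t : Tm) (σ : ℕ → Tm) :
    (app₂ f s t).subst σ = app₂ f (s.subst σ) (t.subst σ) :=
  congrArg (Tm.app f) (funext fun i => by fin_cases i <;> rfl)

@[simp] theorem app₁_relabel (f : PRSymb 1) (t : Tm) :
    (app₁ f t).relabel Nat.succ = app₁ f (t.relabel Nat.succ) := by
  simp only [relabel_eq_subst, app₁_subst]

@[simp] theorem app₂_relabel (f : PRSymb 2) (s t : Tm) :
    (app₂ f s t).relabel Nat.succ = app₂ f (s.relabel Nat.succ) (t.relabel Nat.succ) := by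
  simp only [relabel_eq_subst, app₂_subst]

@[simp] theorem app₁_varFinset (f : PRSymb 1) (t : Tm) :
    (app₁ f t).varFinset = t.varFinset := by
  ext m
  simp [app₁]

@[simp] theorem app₂_varFinset (f : PRSymb 2) (s t : Tm) :
    (app₂ f s t).varFinset = s.varFinset ∪ t.varFinset := by
  ext m
  simp [app₂]

@[simp] theorem v_subst (n : ℕ) (σ : ℕ → Tm) : (Tm.v n).subst σ = σ n := rfl

end Tm

theorem Fml.eq_shift (s t : Tm) :
    (Fml.eq s t).shift = Fml.eq (s.relabel Nat.succ) (t.relabel Nat.succ) := by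
  simp only [Fml.shift, Fml.subst, Tm.subst_v_succ]

namespace Derives

theorem eq_symm (h : Derives T Γ (Fml.eq s t)) : Derives T Γ (Fml.eq t s) := by
  have := eqSubst (φ := Fml.eq (Tm.v 0) (s.relabel Nat.succ)) h
  simp only [Fml.inst, Fml.subst, Tm.relabel_succ_subst_scons, Tm.subst_var, Tm.v_subst,
    scons_zero] at this
  exact this (eqRefl s)

theorem eq_trans (h : Derives T Γ (Fml.eq r s)) (h' : Derives T Γ (Fml.eq s t)) :
    Derives T Γ (Fml.eq r t) := by
  have := eqSubst (φ := Fml.eq (r.relabel Nat.succ) (Tm.v 0)) h'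
  simp only [Fml.inst, Fml.subst, Tm.relabel_succ_subst_scons, Tm.subst_var, Tm.v_subst,
    scons_zero] at this
  exact this h

/-- Equal terms may be substituted into a term. -/
theorem eq_congr (r : Tm) (h : Derives T Γ (Fml.eq s t)) :
    Derives T Γ (Fml.eq (r.subst (scons s Tm.v)) (r.subst (scons t Tm.v))) := by
  have := eqSubst (φ := Fml.eq ((r.subst (scons s Tm.v)).relabel Nat.succ) r) h
  simp only [Fml.inst, Fml.subst, Tm.relabel_succ_subst_scons, Tm.subst_var] at this
  exact this (eqRefl _)

theorem succ_congr (h : Derives T Γ (Fml.eq s t)) :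
    Derives T Γ (Fml.eq (Tm.succ s) (Tm.succ t)) :=
  eq_congr (Tm.succ (Tm.v 0)) h

theorem app₂_congr (f : PRSymb 2) (h : Derives T Γ (Fml.eq s s')) (h' : Derives T Γ (Fml.eq t t')) :
    Derives T Γ (Fml.eq (Tm.app₂ f s t) (Tm.app₂ f s' t')) := by
  have e := eq_congr (Tm.app₂ f (Tm.v 0) (t.relabel Nat.succ)) h
  have e' := eq_congr (Tm.app₂ f (s'.relabel Nat.succ) (Tm.v 0)) h'
  simp only [Tm.app₂_subst, Tm.relabel_succ_subst_scons, Tm.subst_var, Tm.v_subst,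
    scons_zero] at e e'
  exact eq_trans e e'

theorem comp_one (hT : HA ⊆ T) {n : ℕ} (f : PRSymb 1) (g : PRSymb n) (ts : Fin n → Tm) :
    Derives T Γ (Fml.eq (Tm.app (PRSymb.comp f ![g]) ts) (Tm.app₁ f (Tm.app g ts))) := by
  have := ha (Γ := Γ) hT (.comp f ![g] ts)
  rwa [show (fun i => Tm.app (![g] i) ts) = ![Tm.app g ts] from
    funext fun i => by fin_cases i; rfl] at this

theorem comp_two (hT : HA ⊆ T) {n : ℕ} (f : PRSymb 2) (g h : PRSymb n) (ts : Fin n → Tm) :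
    Derives T Γ (Fml.eq (Tm.app (PRSymb.comp f ![g, h]) ts)
      (Tm.app₂ f (Tm.app g ts) (Tm.app h ts))) := by
  have := ha (Γ := Γ) hT (.comp f ![g, h] ts)
  rwa [show (fun i => Tm.app (![g, h] i) ts) = ![Tm.app g ts, Tm.app h ts] from
    funext fun i => by fin_cases i <;> rfl] at this

theorem app₁_prec_zero (hT : HA ⊆ T) (g : PRSymb 2) :
    Derives T Γ (Fml.eq (Tm.app₁ (PRSymb.prec PRSymb.zero g) Tm.zero) Tm.zero) := by
  have := ha (Γ := Γ) hT (.prec_zero PRSymb.zero g ![])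
  rwa [show Tm.app PRSymb.zero ![] = Tm.zero from congrArg _ (funext fun i => i.elim0)] at this

theorem app₁_prec_succ (hT : HA ⊆ T) (g : PRSymb 2) (t : Tm) :
    Derives T Γ (Fml.eq (Tm.app₁ (PRSymb.prec PRSymb.zero g) (Tm.succ t))
      (Tm.app₂ g t (Tm.app₁ (PRSymb.prec PRSymb.zero g) t))) :=
  ha hT (.prec_succ PRSymb.zero g t ![])

theorem app₂_prec_zero (hT : HA ⊆ T) (f : PRSymb 1) (g : PRSymb 3) (t : Tm) :
    Derives T Γ (Fml.eq (Tm.app₂ (PRSymb.prec f g) Tm.zero t) (Tm.app₁ f t)) :=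
  ha hT (.prec_zero f g ![t])

theorem app₂_prec_succ (hT : HA ⊆ T) (f : PRSymb 1) (g : PRSymb 3) (s t : Tm) :
    Derives T Γ (Fml.eq (Tm.app₂ (PRSymb.prec f g) (Tm.succ s) t)
      (Tm.app g ![s, Tm.app₂ (PRSymb.prec f g) s t, t])) :=
  ha hT (.prec_succ f g s ![t])

theorem proj_eq (hT : HA ⊆ T) {n : ℕ} (i : Fin n) (ts : Fin n → Tm) :
    Derives T Γ (Fml.eq (Tm.app (PRSymb.proj i) ts) (ts i)) :=
  ha hT (.proj i ts)

end Derives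

end Equality

/-! ### A primitive recursive enumeration of pairs -/

namespace PRSymb

/-- `pred (x, a)` is `a` if `x = 0`, and the predecessor of `x` otherwise. -/
def pred : PRSymb 2 := prec (proj 0) (proj 0)

/-- `incr (x, r)` is `r + 1` if `x = 0`, and `r` otherwise. -/
def incr : PRSymb 2 := prec succ (proj 2)

/-- Addition, by recursion on the first argument. -/
def add : PRSymb 2 := prec (proj 0) (comp succ ![proj 1])

/-- The truncated subtraction `sub (x, y) = y - x`. -/
def sub : PRSymb 2 := prec (proj 0) (comp pred ![proj 1, proj 1])

/-- The countdown `0, 1, 0, 3, 2, 1, 0, 7, …`: it decreases by one until it is `0`, and then begins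
again at the current argument. -/
def down : PRSymb 1 := prec zero (comp pred ![proj 1, comp succ ![proj 0] ])

/-- The number of times that `down` has begun again so far. -/
def block : PRSymb 1 := prec zero (comp incr ![comp down ![proj 0], proj 1])

end PRSymb

open PRSymb Tm

section Pairing

variable {T : Set Fml} {Γ : List Fml}

namespace Derives

theorem pred_zero (hT : HA ⊆ T) (a : Tm) : Derives T Γ (Fml.eq (app₂ pred Tm.zero a) a) :=
  eq_trans (app₂_prec_zero hT _ _ a) (proj_eq hT 0 ![a])

theorem pred_succ (hT : HA ⊆ T) (t a : Tm) :
    Derives T Γ (Fml.eq (app₂ pred (Tm.succ t) a) t) :=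
  eq_trans (app₂_prec_succ hT _ _ t a) (proj_eq hT 0 _)

theorem incr_zero (hT : HA ⊆ T) (a : Tm) :
    Derives T Γ (Fml.eq (app₂ incr Tm.zero a) (Tm.succ a)) := by
  have := app₂_prec_zero (Γ := Γ) hT PRSymb.succ (proj 2) a
  rwa [show app₁ PRSymb.succ a = Tm.succ a from
    congrArg (Tm.app PRSymb.succ) (funext fun i => by fin_cases i; rfl)] at this

theorem incr_succ (hT : HA ⊆ T) (t a : Tm) :
    Derives T Γ (Fml.eq (app₂ incr (Tm.succ t) a) a) :=
  eq_trans (app₂_prec_succ hT _ _ t a) (proj_eq hT 2 _)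

theorem comp_succ (hT : HA ⊆ T) {n : ℕ} (i : Fin n) (ts : Fin n → Tm) :
    Derives T Γ (Fml.eq (Tm.app (comp PRSymb.succ ![proj i]) ts) (Tm.succ (ts i))) := by
  have := comp_one (Γ := Γ) hT PRSymb.succ (proj i) ts
  rw [show app₁ PRSymb.succ (Tm.app (proj i) ts) = Tm.succ (Tm.app (proj i) ts) from
    congrArg (Tm.app PRSymb.succ) (funext fun i => by fin_cases i; rfl)] at this
  exact eq_trans this (succ_congr (proj_eq hT i ts))

theorem add_zero_left (hT : HA ⊆ T) (a : Tm) : Derives T Γ (Fml.eq (app₂ add Tm.zero a) a) :=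
  eq_trans (app₂_prec_zero hT _ _ a) (proj_eq hT 0 ![a])

theorem add_succ_left (hT : HA ⊆ T) (t a : Tm) :
    Derives T Γ (Fml.eq (app₂ add (Tm.succ t) a) (Tm.succ (app₂ add t a))) :=
  eq_trans (app₂_prec_succ hT _ _ t a) (comp_succ hT 1 _)

theorem sub_zero_left (hT : HA ⊆ T) (a : Tm) : Derives T Γ (Fml.eq (app₂ sub Tm.zero a) a) :=
  eq_trans (app₂_prec_zero hT _ _ a) (proj_eq hT 0 ![a])

theorem sub_succ_left (hT : HA ⊆ T) (t a : Tm) :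
    Derives T Γ (Fml.eq (app₂ sub (Tm.succ t) a) (app₂ pred (app₂ sub t a) (app₂ sub t a))) :=
  eq_trans (app₂_prec_succ hT _ _ t a) (eq_trans (comp_two hT _ _ _ _)
    (app₂_congr _ (proj_eq hT 1 _) (proj_eq hT 1 _)))

theorem down_succ (hT : HA ⊆ T) (z : Tm) :
    Derives T Γ (Fml.eq (app₁ down (Tm.succ z)) (app₂ pred (app₁ down z) (Tm.succ z))) :=
  eq_trans (app₁_prec_succ hT _ z) (eq_trans (comp_two hT _ _ _ _)
    (app₂_congr _ (proj_eq hT 1 _) (comp_succ hT 0 _)))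

theorem block_succ (hT : HA ⊆ T) (z : Tm) :
    Derives T Γ (Fml.eq (app₁ block (Tm.succ z)) (app₂ incr (app₁ down z) (app₁ block z))) := by
  refine eq_trans (app₁_prec_succ hT _ z) (eq_trans (comp_two hT _ _ _ _)
    (app₂_congr _ (eq_trans (comp_one hT _ _ _) ?_) (proj_eq hT 1 _)))
  have := eq_congr (app₁ down (Tm.v 0)) (proj_eq (Γ := Γ) hT 0 ![z, app₁ block z])
  simp only [app₁_subst, v_subst, scons_zero] at this
  exact this

variable {d x n y z z' x' n' t : Tm}

theorem down_succ_of_zero (hT : HA ⊆ T) (h : Derives T Γ (Fml.eq (app₁ down z) Tm.zero)) :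
    Derives T Γ (Fml.eq (app₁ down (Tm.succ z)) (Tm.succ z)) :=
  eq_trans (down_succ hT z) (eq_trans (app₂_congr _ h (eqRefl _)) (pred_zero hT _))

theorem block_succ_of_zero (hT : HA ⊆ T) (h : Derives T Γ (Fml.eq (app₁ down z) Tm.zero)) :
    Derives T Γ (Fml.eq (app₁ block (Tm.succ z)) (Tm.succ (app₁ block z))) :=
  eq_trans (block_succ hT z) (eq_trans (app₂_congr _ h (eqRefl _)) (incr_zero hT _))

theorem down_succ_of_succ (hT : HA ⊆ T) (h : Derives T Γ (Fml.eq (app₁ down z) (Tm.succ x))) :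
    Derives T Γ (Fml.eq (app₁ down (Tm.succ z)) x) :=
  eq_trans (down_succ hT z) (eq_trans (app₂_congr _ h (eqRefl _)) (pred_succ hT _ _))

theorem block_succ_of_succ (hT : HA ⊆ T) (h : Derives T Γ (Fml.eq (app₁ down z) (Tm.succ x))) :
    Derives T Γ (Fml.eq (app₁ block (Tm.succ z)) (app₁ block z)) :=
  eq_trans (block_succ hT z) (eq_trans (app₂_congr _ h (eqRefl _)) (incr_succ hT _ _))

theorem add_zero_right (hT : HA ⊆ T) (t : Tm) : Derives T Γ (Fml.eq (app₂ add t Tm.zero) t) := by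
  have := induction (Γ := Γ) hT (φ := Fml.eq (app₂ add (Tm.v 0) Tm.zero) (Tm.v 0)) t
  simp only [Fml.inst, Fml.instSucc, Fml.subst, app₂_subst, v_subst, scons_zero,
    zero_subst] at this
  exact this (add_zero_left hT _) (eq_trans (add_succ_left hT _ _) (succ_congr h0))

theorem add_succ_right (hT : HA ⊆ T) (t a : Tm) :
    Derives T Γ (Fml.eq (app₂ add t (Tm.succ a)) (Tm.succ (app₂ add t a))) := by
  have := induction (Γ := Γ) hT
    (φ := Fml.eq (app₂ add (Tm.v 0) (Tm.succ (a.relabel Nat.succ)))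
      (Tm.succ (app₂ add (Tm.v 0) (a.relabel Nat.succ)))) t
  simp only [Fml.inst, Fml.instSucc, Fml.subst, app₂_subst, v_subst, scons_zero, Tm.succ_subst,
    relabel_succ_subst_scons, subst_var, subst_v_succ] at this
  exact this (eq_trans (add_zero_left hT _) (succ_congr (eq_symm (add_zero_left hT _))))
    (eq_trans (add_succ_left hT _ _) (succ_congr (eq_trans h0 (eq_symm (add_succ_left hT _ _)))))

theorem sub_succ_succ (hT : HA ⊆ T) (t a : Tm) :
    Derives T Γ (Fml.eq (app₂ sub (Tm.succ t) (Tm.succ a)) (app₂ sub t a)) := by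
  have := induction (Γ := Γ) hT
    (φ := Fml.eq (app₂ sub (Tm.succ (Tm.v 0)) (Tm.succ (a.relabel Nat.succ)))
      (app₂ sub (Tm.v 0) (a.relabel Nat.succ))) t
  simp only [Fml.inst, Fml.instSucc, Fml.subst, app₂_subst, v_subst, scons_zero, Tm.succ_subst,
    relabel_succ_subst_scons, subst_var, subst_v_succ] at this
  exact this
    (eq_trans (sub_succ_left hT _ _) (eq_trans (app₂_congr _ (sub_zero_left hT _)
      (sub_zero_left hT _)) (eq_trans (pred_succ hT _ _) (eq_symm (sub_zero_left hT _)))))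
    (eq_trans (sub_succ_left hT _ _) (eq_trans (app₂_congr _ h0 h0)
      (eq_symm (sub_succ_left hT _ _))))

theorem sub_add (hT : HA ⊆ T) (t a : Tm) :
    Derives T Γ (Fml.eq (app₂ sub t (app₂ add a t)) a) := by
  have := induction (Γ := Γ) hT
    (φ := Fml.eq (app₂ sub (Tm.v 0) (app₂ add (a.relabel Nat.succ) (Tm.v 0)))
      (a.relabel Nat.succ)) t
  simp only [Fml.inst, Fml.instSucc, Fml.subst, app₂_subst, v_subst, scons_zero,
    relabel_succ_subst_scons, subst_var, subst_v_succ] at this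
  exact this (eq_trans (sub_zero_left hT _) (add_zero_right hT _))
    (eq_trans (app₂_congr _ (eqRefl _) (add_succ_right hT _ _))
      (eq_trans (sub_succ_succ hT _ _) h0))

/-- Case distinction on whether a term is `0` or a successor. -/
theorem zero_or_succ (hT : HA ⊆ T) (t : Tm) : Derives T Γ (Fml.or (Fml.eq t Tm.zero)
    (Fml.eq (t.relabel Nat.succ) (Tm.succ (Tm.v 0))).ex) := by
  have := induction (Γ := Γ) hT (φ := Fml.or (Fml.eq (Tm.v 0) Tm.zero)
    (Fml.eq (Tm.v 1) (Tm.succ (Tm.v 0))).ex) t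
  simp only [Fml.inst, Fml.instSucc, Fml.subst, v_subst, scons_zero, Tm.succ_subst, zero_subst,
    lift_zero, lift_succ _ 0] at this
  refine this (orI₁ (eqRefl _)) (orI₂ (exI (Tm.v 0) ?_))
  exact eqRefl _

end Derives

/-- Some `z` satisfies `down z = x` and `block z = n`. -/
def Reach (x n : Tm) : Fml :=
  (Fml.and (Fml.eq (app₁ down (Tm.v 0)) (x.relabel Nat.succ))
    (Fml.eq (app₁ block (Tm.v 0)) (n.relabel Nat.succ))).ex

/-- Every `z` with `down z = t + x` can be followed, in its block, by some `z'` with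
`down z' = x`. -/
def Descent (x t : Tm) : Fml :=
  (Fml.imp (Fml.eq (app₁ down (Tm.v 0)) (app₂ add (t.relabel Nat.succ) (x.relabel Nat.succ)))
    (Reach (x.relabel Nat.succ) (app₁ block (Tm.v 0)))).all

/-- The inequality `block t ≤ t`. -/
def BlockLe (t : Tm) : Fml :=
  (Fml.eq (t.relabel Nat.succ) (app₂ add (Tm.v 0) (app₁ block (t.relabel Nat.succ)))).ex

theorem Reach_subst (x n : Tm) (σ : ℕ → Tm) :
    (Reach x n).subst σ = Reach (x.subst σ) (n.subst σ) := by
  simp only [Reach, Fml.subst, app₁_subst, v_subst, lift_zero, relabel_succ_subst_lift]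

theorem Descent_subst (x t : Tm) (σ : ℕ → Tm) :
    (Descent x t).subst σ = Descent (x.subst σ) (t.subst σ) := by
  simp only [Descent, Fml.subst, Reach_subst, app₁_subst, app₂_subst, v_subst, lift_zero,
    relabel_succ_subst_lift]

theorem BlockLe_subst (t : Tm) (σ : ℕ → Tm) :
    (BlockLe t).subst σ = BlockLe (t.subst σ) := by
  simp only [BlockLe, Fml.subst, app₁_subst, app₂_subst, v_subst, lift_zero,
    relabel_succ_subst_lift]

theorem Reach_shift (x n : Tm) :
    (Reach x n).shift = Reach (x.relabel Nat.succ) (n.relabel Nat.succ) := by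
  simp only [Fml.shift, Reach_subst, subst_v_succ]

theorem Descent_shift (x t : Tm) :
    (Descent x t).shift = Descent (x.relabel Nat.succ) (t.relabel Nat.succ) := by
  simp only [Fml.shift, Descent_subst, subst_v_succ]

theorem BlockLe_shift (t : Tm) : (BlockLe t).shift = BlockLe (t.relabel Nat.succ) := by
  simp only [Fml.shift, BlockLe_subst, subst_v_succ]

namespace Derives

variable {d x n y z x' n' t : Tm}

theorem reach_intro (z : Tm) (h : Derives T Γ (Fml.eq (app₁ down z) x))
    (h' : Derives T Γ (Fml.eq (app₁ block z) n)) : Derives T Γ (Reach x n) := by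
  refine exI z ?_
  simp only [Fml.inst, Fml.subst, app₁_subst, v_subst, scons_zero, relabel_succ_subst_scons,
    subst_var]
  exact andI h h'

theorem reach_congr (h : Derives T Γ (Reach x n)) (hx : Derives T Γ (Fml.eq x x'))
    (hn : Derives T Γ (Fml.eq n n')) : Derives T Γ (Reach x' n') := by
  have e := eqSubst (φ := Reach (Tm.v 0) (n.relabel Nat.succ)) hx
  have e' := eqSubst (φ := Reach (x'.relabel Nat.succ) (Tm.v 0)) hn
  simp only [Fml.inst, Reach_subst, v_subst, scons_zero, relabel_succ_subst_scons,
    subst_var] at e e'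
  exact e' (e h)

theorem descent_elim (h : Derives T Γ (Descent x t))
    (h' : Derives T Γ (Fml.eq (app₁ down z) (app₂ add t x))) :
    Derives T Γ (Reach x (app₁ block z)) := by
  have := allE z h
  simp only [Fml.inst, Fml.subst, Reach_subst, app₁_subst, app₂_subst, v_subst, scons_zero,
    relabel_succ_subst_scons, subst_var] at this
  exact impE this h'

/-- One step of the countdown, from `z` to `z + 1`, makes the distance to `x` smaller by one. -/
theorem descent_succ (hT : HA ⊆ T) (h : Derives T Γ (Descent x t))
    (h' : Derives T Γ (Fml.eq (app₁ down z) (app₂ add (Tm.succ t) x))) :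
    Derives T Γ (Reach x (app₁ block z)) :=
  have e := eq_trans h' (add_succ_left hT t x)
  reach_congr (descent_elim h (down_succ_of_succ hT e)) (eqRefl _) (block_succ_of_succ hT e)

theorem descent (hT : HA ⊆ T) (x t : Tm) : Derives T Γ (Descent x t) := by
  have := induction (Γ := Γ) hT (φ := Descent (x.relabel Nat.succ) (Tm.v 0)) t
  simp only [Fml.inst, Fml.instSucc, Descent_subst, v_subst, scons_zero, relabel_succ_subst_scons,
    subst_var, subst_v_succ] at this
  refine this (allI (impI (reach_intro (Tm.v 0) (eq_trans h0 ?_) (eqRefl _))))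
    (allI (impI (descent_succ hT ?_ h0)))
  · rw [zero_relabel]
    exact add_zero_left hT _
  · rw [List.map_cons, Descent_shift]
    exact h1

theorem blockLe_intro (d : Tm) (h : Derives T Γ (Fml.eq z (app₂ add d (app₁ block z)))) :
    Derives T Γ (BlockLe z) := by
  refine exI d ?_
  simp only [Fml.inst, Fml.subst, app₁_subst, app₂_subst, v_subst, scons_zero,
    relabel_succ_subst_scons, subst_var]
  exact h

theorem blockLe (hT : HA ⊆ T) (t : Tm) : Derives T Γ (BlockLe t) := by
  have := induction (Γ := Γ) hT (φ := BlockLe (Tm.v 0)) t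
  simp only [Fml.inst, Fml.instSucc, BlockLe_subst, v_subst, scons_zero] at this
  refine this (blockLe_intro Tm.zero (eq_symm (eq_trans (add_zero_left hT _)
    (app₁_prec_zero hT _)))) (exE h0 ?_)
  rw [BlockLe_shift]
  simp only [succ_relabel, v_relabel]
  refine orE (zero_or_succ hT (app₁ down (Tm.v 1))) (blockLe_intro (Tm.v 0) ?_) (exE h0 ?_)
  · exact eq_trans (succ_congr h1) (eq_symm (eq_trans (app₂_congr _ (eqRefl _)
      (block_succ_of_zero hT h0)) (add_succ_right hT _ _)))
  · rw [BlockLe_shift]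
    refine blockLe_intro (Tm.succ (Tm.v 1)) ?_
    simp only [List.map_cons, Fml.eq_shift, app₁_relabel, app₂_relabel, succ_relabel, v_relabel]
    exact eq_trans (succ_congr h2) (eq_symm (eq_trans (app₂_congr _ (eqRefl _)
      (block_succ_of_succ hT h0)) (add_succ_left hT _ _)))

theorem reach_of_down_eq_add (hT : HA ⊆ T) (h : Derives T Γ (Fml.eq (app₁ down z) (app₂ add t x)))
    (h' : Derives T Γ (Fml.eq (app₁ block z) n)) : Derives T Γ (Reach x n) :=
  reach_congr (descent_elim (descent hT x t) h) (eqRefl _) h'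

/-- At the end `z` of the block `n` a new countdown begins, at `z + 1`; since `n ≤ z`, it passes
through `n + 1`. -/
theorem reach_succ_self (hT : HA ⊆ T) (h : Derives T Γ (Fml.eq (app₁ down z) Tm.zero))
    (h' : Derives T Γ (Fml.eq (app₁ block z) n))
    (hd : Derives T Γ (Fml.eq z (app₂ add d (app₁ block z)))) :
    Derives T Γ (Reach (Tm.succ n) (Tm.succ n)) := by
  have hb := succ_congr h'
  refine reach_of_down_eq_add (z := Tm.succ z) (t := d) hT
    (eq_trans (down_succ_of_zero hT h) (eq_trans (succ_congr hd) ?_))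
    (eq_trans (block_succ_of_zero hT h) hb)
  exact eq_trans (eq_symm (add_succ_right hT _ _)) (app₂_congr _ (eqRefl _) hb)

/-- By induction on `n`: from `(n, n)` the countdown goes on to the end `(0, n)` of the block, and
the next block contains `(n + 1, n + 1)`. -/
theorem reach_self (hT : HA ⊆ T) (t : Tm) : Derives T Γ (Reach t t) := by
  have := induction (Γ := Γ) hT (φ := Reach (Tm.v 0) (Tm.v 0)) t
  simp only [Fml.inst, Fml.instSucc, Reach_subst, v_subst, scons_zero] at this
  refine this (reach_intro Tm.zero (app₁_prec_zero hT _) (app₁_prec_zero hT _)) ?_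
  have last : Derives T (Reach (Tm.v 0) (Tm.v 0) :: Γ.map Fml.shift) (Reach Tm.zero (Tm.v 0)) := by
    refine exE h0 ?_
    rw [Reach_shift]
    simp only [zero_relabel, v_relabel]
    exact reach_of_down_eq_add hT (eq_trans (andE₁ h0) (eq_symm (add_zero_right hT _))) (andE₂ h0)
  refine exE last ?_
  rw [Reach_shift]
  simp only [zero_relabel, succ_relabel, v_relabel]
  refine exE (blockLe hT (Tm.v 0)) ?_
  rw [Reach_shift]
  simp only [List.map_cons, Fml.shift, Fml.subst, app₁_subst, v_subst, zero_subst, succ_relabel,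
    v_relabel]
  exact reach_succ_self hT (andE₁ h1) (andE₂ h1) h0

/-- Every pair `(x, n)` of the form `(x, y + x)` is reached. -/
theorem reach_add (hT : HA ⊆ T) (y x : Tm) : Derives T Γ (Reach x (app₂ add y x)) := by
  refine exE (reach_self hT (app₂ add y x)) ?_
  rw [Reach_shift]
  simp only [app₂_relabel]
  exact reach_of_down_eq_add hT (andE₁ h0) (andE₂ h0)

end Derives

end Pairing

/-! ### Reduction to one parameter -/

section Parameters

variable {T : Set Fml} {Γ : List Fml}

theorem Fml.exists_bound_FV (φ : Fml) : ∃ N, ∀ n ∈ φ.FV, n < N := by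
  have union {A B : Set ℕ} (h : ∃ N, ∀ n ∈ A, n < N) (h' : ∃ N, ∀ n ∈ B, n < N) :
      ∃ N, ∀ n ∈ A ∪ B, n < N := by
    obtain ⟨N, h⟩ := h
    obtain ⟨N', h'⟩ := h'
    exact ⟨max N N', fun n hn =>
      hn.elim (fun H => lt_max_of_lt_left (h n H)) fun H => lt_max_of_lt_right (h' n H)⟩
  have term (t : Tm) : ∃ N, ∀ n ∈ (t.varFinset : Set ℕ), n < N :=
    ⟨t.varFinset.sup id + 1, fun n hn => Nat.lt_succ_of_le (Finset.le_sup (f := id) hn)⟩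
  induction φ with
  | bot => exact ⟨0, fun n hn => hn.elim⟩
  | eq s t => exact union (term s) (term t)
  | and φ ψ h h' | or φ ψ h h' | imp φ ψ h h' => exact union h h'
  | all φ h | ex φ h =>
    obtain ⟨N, h⟩ := h
    exact ⟨N, fun n hn => (Nat.lt_succ_self n).trans (h _ hn)⟩

/-- The universal closure of a formula implies the formula. -/
theorem Derives.of_closure {N : ℕ} {φ : Fml} (hφ : ∀ n ∈ φ.FV, n < N)
    (h : Derives T Γ (Fml.all^[N] φ)) : Derives T Γ φ := by
  -- The outer variable `m` instantiates the quantifier that is removed; the offset `m` keeps the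
  -- variables of the enclosing formula apart from those already restored.
  have key (N : ℕ) : ∀ (φ : Fml) (m : ℕ),
      Derives T Γ ((Fml.all^[N] φ).subst fun n => Tm.v (n + N + m)) →
        Derives T Γ (φ.subst fun n => Tm.v (n + m)) := by
    induction N with
    | zero => exact fun φ m h => h
    | succ N ih =>
      intro φ m h
      have h' := ih φ.all (m + 1) (by
        refine Eq.mp (congrArg _ (congrArg _ (funext fun n => congrArg _ ?_))) h
        omega)
      have := allE (Tm.v m) h'
      rw [Fml.subst_lift_inst] at this
      refine Eq.mp (congrArg _ (congrArg _ (funext fun n => ?_))) this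
      cases n with
      | zero => simp
      | succ n => simp only [scons_succ]; congr 1; omega
  have closed : ∀ n, n ∉ (Fml.all^[N] φ).FV := by
    have (N : ℕ) : ∀ n, n ∈ (Fml.all^[N] φ).FV ↔ n + N ∈ φ.FV := by
      induction N with
      | zero => exact fun n => Iff.rfl
      | succ N ih =>
        intro n
        rw [Function.iterate_succ_apply']
        refine (ih (n + 1)).trans ?_
        rw [Nat.add_right_comm, Nat.add_assoc]
    intro n hn
    have := hφ _ ((this N n).1 hn)
    omega
  have := key N φ 0 (by
    rwa [Fml.subst_congr (τ := Tm.v) fun n hn => (closed n hn).elim, Fml.subst_v])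
  rwa [show (fun n => Tm.v (n + 0)) = Tm.v from rfl, Fml.subst_v] at this

/-- Monotonicity of `∀` under any number of quantifiers. No substitution into derivations is needed,
because `φ` is the only assumption. -/
theorem Derives.iterate_all_mono {φ ψ : Fml} (h : Derives T [φ] ψ) (N : ℕ) :
    Derives T [Fml.all^[N] φ] (Fml.all^[N] ψ) := by
  induction N with
  | zero => exact h
  | succ N ih =>
    rw [Function.iterate_succ_apply', Function.iterate_succ_apply']
    exact allI (cut (allE_shift h0) (ih.weaken (by simp)))

/-- The substitution that replaces the variables `0` and `1` by the components of the pair with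
number `0`, and moves the other variables down by one. -/
def unpair : ℕ → Tm :=
  scons (app₁ down (Tm.v 0)) (scons (app₂ sub (app₁ down (Tm.v 0)) (app₁ block (Tm.v 0)))
    fun n => Tm.v (n + 1))

/-- The terms substituted for the variables `0` and `1` may be replaced by equal ones. -/
theorem Derives.subst_scons_congr {φ : Fml} {s t s' t' : Tm} (σ : ℕ → Tm)
    (h : Derives T Γ (Fml.eq s s')) (h' : Derives T Γ (Fml.eq t t'))
    (hφ : Derives T Γ (φ.subst (scons s (scons t σ)))) :
    Derives T Γ (φ.subst (scons s' (scons t' σ))) := by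
  have e := eqSubst (φ := φ.subst (lift (scons t σ))) h
  rw [Fml.subst_lift_inst, Fml.subst_lift_inst] at e
  have e' := eqSubst (φ := φ.subst (scons (s'.relabel Nat.succ) (lift σ))) h'
  have aux (t : Tm) : (φ.subst (scons (s'.relabel Nat.succ) (lift σ))).inst t =
      φ.subst (scons s' (scons t σ)) := by
    rw [Fml.inst, Fml.subst_subst]
    congr 1
    funext n
    rcases n with _ | _ | n <;> simp [Tm.subst_var]
  rw [aux, aux] at e'
  exact e' (e hφ)

/-- Two universal quantifiers may be contracted to one: every pair has a number. -/
theorem Derives.all_all_of_unpair (hT : HA ⊆ T) (φ : Fml) :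
    Derives T [(φ.subst unpair).all] φ.all.all := by
  refine allI (allI (exE (reach_add hT (Tm.v 1) (Tm.v 0)) ?_))
  simp only [app₂_relabel, v_relabel]
  have e : ((((φ.subst unpair).subst (lift fun n => Tm.v (n + 1))).subst
      (lift fun n => Tm.v (n + 1))).subst (lift fun n => Tm.v (n + 1))).inst (Tm.v 0) =
      φ.subst (scons (app₁ down (Tm.v 0)) (scons (app₂ sub (app₁ down (Tm.v 0))
        (app₁ block (Tm.v 0))) fun n => Tm.v (n + 3))) := by
    simp only [Fml.inst, Fml.subst_subst]
    congr 1
    funext n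
    rcases n with _ | _ | n <;> simp [unpair]
  have h {ψ : Fml} : Derives T [ψ, (φ.subst unpair).all.shift.shift.shift] _ :=
    allE (Tm.v 0) h1
  rw [e] at h
  have := subst_scons_congr (s' := Tm.v 1) (t' := Tm.v 2) _ (andE₁ h0) (eq_trans
    (app₂_congr sub (s' := Tm.v 1) (t' := app₂ add (Tm.v 2) (Tm.v 1)) (andE₁ h0) (andE₂ h0))
    (sub_add hT _ _)) h
  have e' : (scons (Tm.v 1) (scons (Tm.v 2) fun n => Tm.v (n + 3))) = fun n => Tm.v (n + 1) := by
    funext n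
    rcases n with _ | _ | n <;> rfl
  rw [e'] at this
  exact this

/-- A schema that is closed under substitution is provable with arbitrarily many parameters if it is
provable with one. -/
theorem provable_of_one_parameter (hT : HA ⊆ T) {S : Set Fml}
    (hS : ∀ φ ∈ S, ∀ σ, φ.subst σ ∈ S) (h : ∀ φ ∈ S, φ.FV ⊆ {0} → Provable T φ.all) :
    ∀ φ ∈ S, Provable T φ := by
  have key (N : ℕ) : ∀ φ ∈ S, (∀ n ∈ φ.FV, n < N + 1) → Provable T (Fml.all^[N + 1] φ) := by
    -- Contracting the two outermost parameters leaves a formula with one variable less.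
    induction N with
    | zero => exact fun φ hφ hN => h φ hφ fun n hn => Nat.lt_one_iff.1 (hN n hn)
    | succ N ih =>
      intro φ hφ hN
      refine cut (ih _ (hS φ hφ unpair) fun n hn => ?_)
        (iterate_all_mono (all_all_of_unpair hT φ) N)
      obtain ⟨m, hm, hn⟩ := Fml.mem_FV_subst.1 hn
      have := hN m hm
      rcases m with _ | _ | m <;> simp [unpair] at hn <;> omega
  intro φ hφ
  obtain ⟨N, hN⟩ := φ.exists_bound_FV
  exact of_closure (fun n hn => (hN n hn).trans (Nat.lt_succ_self N))
    (key N φ hφ fun n hn => (hN n hn).trans (Nat.lt_succ_self N))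

end Parameters

/-! ### The principles with one parameter -/

theorem provesDNEAndDNS_of_subset {T : Set Fml} {k : ℕ} (hT : HA ⊆ T)
    (hDNE : DNE (SigmaClass k) ⊆ T) (hDNS : DNS (UPlus k) ⊆ T) : ProvesDNEAndDNS T k where
  dne φ hφ := by
    refine provable_of_one_parameter hT (S := {χ | ∃ φ ∈ prenex true k, χ = Fml.imp φ.nn φ})
      ?_ ?_ _ ⟨φ, hφ, rfl⟩
    · rintro _ ⟨φ, hφ, rfl⟩ σ
      exact ⟨φ.subst σ, subst_mem_prenex hφ σ, rfl⟩
    · rintro _ ⟨φ, hφ, rfl⟩ hv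
      exact .ax (hDNE ⟨φ, hφ, fun n hn => hv (Or.inr hn), rfl⟩)
  dns φ hφ := by
    refine provable_of_one_parameter hT
      (S := {χ | ∃ φ, SignBounded false k φ ∧ χ = Fml.imp φ.nn.all φ.all.nn}) ?_ ?_ _ ⟨φ, hφ, rfl⟩
    · rintro _ ⟨φ, hφ, rfl⟩ σ
      exact ⟨φ.subst (lift σ), hφ.subst _, rfl⟩
    · rintro _ ⟨φ, hφ, rfl⟩ hv
      refine .ax (hDNS ⟨φ, mem_UPlus_iff.2 hφ, ?_, rfl⟩)
      rintro (_ | n) hn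
      · exact Or.inl rfl
      · have : n = 0 := hv (Or.inr (Or.inl (Or.inl hn)))
        exact Or.inr (congrArg (· + 1) this)

theorem provesDNEOr_of_subset {T : Set Fml} {k : ℕ} (hT : HA ⊆ T)
    (h : DNEOr (PiClass k) (PiClass k) ⊆ T) : ProvesDNEOr T k := by
  intro φ hφ ψ hψ
  refine provable_of_one_parameter hT (S := {χ | ∃ φ ∈ prenex false k, ∃ ψ ∈ prenex false k,
    χ = Fml.imp (Fml.or φ ψ).nn (Fml.or φ ψ)}) ?_ ?_ _ ⟨φ, hφ, ψ, hψ, rfl⟩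
  · rintro _ ⟨φ, hφ, ψ, hψ, rfl⟩ σ
    exact ⟨φ.subst σ, subst_mem_prenex hφ σ, ψ.subst σ, subst_mem_prenex hψ σ, rfl⟩
  · rintro _ ⟨φ, hφ, ψ, hψ, rfl⟩ hv
    exact .ax (h ⟨φ, hφ, ψ, hψ, fun n hn => hv (Or.inr (Or.inl hn)),
      fun n hn => hv (Or.inr (Or.inr hn)), rfl⟩)

end HeytingArith

theorem mainTheorem1 (k : ℕ) (φ : Fml) :
    (φ ∈ EPlus k →
      ∃ φ' ∈ SigmaClass k, φ.FV = φ'.FV ∧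
        Provable (HA ∪ DNE (SigmaClass k) ∪ DNS (UPlus k)) (Fml.iff φ φ')) ∧
    (φ ∈ UPlus k →
      ∃ φ' ∈ PiClass k, φ.FV = φ'.FV ∧
        Provable (HA ∪ DNEOr (PiClass k) (PiClass k)) (Fml.iff φ φ')) := by
  refine ⟨fun h => ?_, fun h => ?_⟩
  · have hT : HA ⊆ HA ∪ DNE (SigmaClass k) ∪ DNS (UPlus k) := fun _ h => Or.inl (Or.inl h)
    exact (((prenexAt k).sigma hT (provesDNEAndDNS_of_subset hT (fun _ h => Or.inl (Or.inr h))
      fun _ h => Or.inr h)) φ).1 (mem_EPlus_iff.1 h)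
  · have hT : HA ⊆ HA ∪ DNEOr (PiClass k) (PiClass k) := fun _ h => Or.inl h
    exact (((prenexAt k).pi hT (provesDNEOr_of_subset hT fun _ h => Or.inr h)) φ).1
      (mem_UPlus_iff.1 h)
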